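/- A PROP is a strict symmetric monoidal category whose monoid of objects is $(\mathbb{N},+,0)$; a morphism of PROPs is an identity-on-objects strict symmetric monoidal functor, and an isomorphism of PROPs is an invertible such morphism. Write $\underline{n}=\{1,\dots,n\}$. Let $\mathsf{Syn}(\delta)$ be the PROP whose morphisms $m\to n$ are isomorphism classes of finite directed acyclic graphs with $m$ linearly ordered input half-edges, $n$ linearly ordered output half-edges, and finitely many internal vertices, each with exactly one incoming half-edge and an ordered pair (left, right) of outgoing half-edges, in which every input half-edge and every outgoing half-edge of a vertex is joined by a wire to exactly one output half-edge or incoming half-edge of a vertex, and conversely. Isomorphisms are bijections of the internal vertices that preserve all wires with their positions at the inputs, outputs and vertices. Composition is gluing of outputs to inputs in order, tensor is disjoint union with concatenated boundaries, and identities and symmetries are the corresponding vertex-free graphs. (This is the graphical model of the free PROP on one generator $\delta:1\to 2$; the generator $\delta$ is the graph with exactly one vertex, whose incoming half-edge is joined to the input and whose left and right outgoing half-edges are joined to the first and second output.) Let $\mathbf{FinCorel}$ be the PROP whose morphisms $m\to n$ are the equivalence relations on $\underline{m}\sqcup\underline{n}$; the composite of $R:m\to n$ and $S:n\to p$ is the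 restriction to $\underline{m}\sqcup\underline{p}$ of the transitive closure of $R\cup S$ on $\underline{m}\sqcup\underline{n}\sqcup\underline{p}$, tensor is disjoint union with reindexing, and identities and symmetries are the equivalence relations matching each input with the corresponding output. For $f:m\to n$ in $\mathsf{Syn}(\delta)$, let $\Pi(f)$ be the equivalence relation on $\underline{m}\sqcup\underline{n}$ for which two boundary elements are equivalent if and only if they lie in the same connected component of the underlying undirected graph of $f$ (with inputs and outputs attached as pendant vertices). Let $\mathbf{Cocom}$ be the PROP freely generated by one morphism $\delta:1\to 2$ subject to $(\delta+\mathrm{id}_1)\circ\delta=(\mathrm{id}_1+\delta)\circ\delta$ and $\sigma_{1,1}\circ\delta=\delta$, where $\sigma_{1,1}:2\to 2$ is the symmetry. Theorem. (1) $\Pi$ is well defined on isomorphism classes and is an identity-on-objects strict symmetric monoidal functor $\mathsf{Syn}(\delta)\to\mathbf{FinCorel}$. (2) The equivalence relations $R:m\to n$ such that (a) every class of $R$ contains exactly one element of $\underline{m}$ and (b) every class of $R$ contains at least one element of $\underline{n}$ form a sub-PROP $\mathbf{FinCorel}^\circ$ of $\mathbf{FinCorel}$, and $\mathbf{FinCorel}^\circ$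 is the image of $\Pi$. (3) Let $\mathsf{AncQ}=\mathsf{Syn}(\delta)/\ker\Pi$, the PROP obtained by identifying $f$ and $g$ whenever $\Pi(f)=\Pi(g)$. The assignment $[f]\mapsto\Pi(f)$ is an isomorphism of PROPs $\mathsf{AncQ}\cong\mathbf{FinCorel}^\circ$. (4) There is an isomorphism of PROPs $\mathbf{Cocom}\cong\mathsf{AncQ}$ sending $\delta$ to the class $[\delta]$. (5) $\mathbf{Cocom}$ is isomorphic to the PROP whose morphisms $m\to n$ are the surjections $\underline{n}\to\underline{m}$, with composition of functions and disjoint union as tensor, by an isomorphism sending $\delta$ to the unique surjection $\underline{2}\to\underline{1}$. -/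

import Mathlib

universe u v

namespace AncestryPROP

open Sum

/-! ### PROPs -/

/-- Transport of an element of a family indexed by two natural numbers along equalities. -/
def castHom {H : ℕ → ℕ → Type u} {m m' n n' : ℕ} (hm : m = m') (hn : n = n') (f : H m n) :
    H m' n' :=
  hn ▸ hm ▸ f

/-- A PROP: a strict symmetric monoidal category with object monoid `(ℕ, +, 0)`.
Composition is written in diagrammatic order, so `comp f g` is the composite `g ∘ f`.
The transports `castHom` only express the strict equalities `(a + b) + c = a + (b + c)` and
`0 + a = a = a + 0` between objects. -/
structure PROP : Type (u + 1) where
  Hom : ℕ → ℕ → Type u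
  id (n : ℕ) : Hom n n
  comp {m n p : ℕ} : Hom m n → Hom n p → Hom m p
  tensor {m n m' n' : ℕ} : Hom m n → Hom m' n' → Hom (m + m') (n + n')
  symm (m n : ℕ) : Hom (m + n) (n + m)
  id_comp {m n : ℕ} (f : Hom m n) : comp (id m) f = f
  comp_id {m n : ℕ} (f : Hom m n) : comp f (id n) = f
  comp_assoc {m n p q : ℕ} (f : Hom m n) (g : Hom n p) (h : Hom p q) :
    comp (comp f g) h = comp f (comp g h)
  tensor_id (m n : ℕ) : tensor (id m) (id n) = id (m + n)
  tensor_comp {m n p m' n' p' : ℕ} (f : Hom m n) (g : Hom n p) (f' : Hom m' n')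
    (g' : Hom n' p') :
    tensor (comp f g) (comp f' g') = comp (tensor f f') (tensor g g')
  tensor_assoc {m n m' n' m'' n'' : ℕ} (f : Hom m n) (g : Hom m' n') (h : Hom m'' n'') :
    castHom (Nat.add_assoc m m' m'') (Nat.add_assoc n n' n'') (tensor (tensor f g) h) =
      tensor f (tensor g h)
  zero_tensor {m n : ℕ} (f : Hom m n) :
    castHom (Nat.zero_add m) (Nat.zero_add n) (tensor (id 0) f) = f
  tensor_zero {m n : ℕ} (f : Hom m n) :
    castHom (Nat.add_zero m) (Nat.add_zero n) (tensor f (id 0)) = f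
  symm_natural {m n m' n' : ℕ} (f : Hom m n) (g : Hom m' n') :
    comp (tensor f g) (symm n n') = comp (symm m m') (tensor g f)
  symm_symm (m n : ℕ) : comp (symm m n) (symm n m) = id (m + n)
  symm_hexagon (m n p : ℕ) :
    castHom (Nat.add_assoc m n p).symm (Nat.add_assoc n p m) (symm m (n + p)) =
      comp (castHom rfl (Nat.add_assoc n m p) (tensor (symm m n) (id p)))
        (tensor (id n) (symm m p))

/-- A morphism of PROPs: an identity-on-objects strict symmetric monoidal functor. -/
@[ext]
structure PROPHom (P : PROP.{u}) (Q : PROP.{v}) where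
  map {m n : ℕ} : P.Hom m n → Q.Hom m n
  map_id (n : ℕ) : map (P.id n) = Q.id n
  map_comp {m n p : ℕ} (f : P.Hom m n) (g : P.Hom n p) :
    map (P.comp f g) = Q.comp (map f) (map g)
  map_tensor {m n m' n' : ℕ} (f : P.Hom m n) (g : P.Hom m' n') :
    map (P.tensor f g) = Q.tensor (map f) (map g)
  map_symm (m n : ℕ) : map (P.symm m n) = Q.symm m n

/-- An isomorphism of PROPs: two mutually inverse morphisms of PROPs. -/
structure PROPIso (P : PROP.{u}) (Q : PROP.{v}) where
  hom : PROPHom P Q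
  inv : PROPHom Q P
  inv_hom {m n : ℕ} (f : P.Hom m n) : inv.map (hom.map f) = f
  hom_inv {m n : ℕ} (g : Q.Hom m n) : hom.map (inv.map g) = g

theorem castHom_map {H : ℕ → ℕ → Type u} {K : ℕ → ℕ → Type v} (F : ∀ {m n : ℕ}, H m n → K m n)
    {m m' n n' : ℕ} (hm : m = m') (hn : n = n') (f : H m n) :
    F (castHom hm hn f) = castHom hm hn (F f) := by
  subst hm hn; rfl

/-- A sub-PROP: a class of morphisms containing the identities and the symmetries and closed
under composition and tensor. -/
structure SubPROP (P : PROP.{u}) where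
  carrier (m n : ℕ) : Set (P.Hom m n)
  id_mem (n : ℕ) : P.id n ∈ carrier n n
  comp_mem {m n p : ℕ} {f : P.Hom m n} {g : P.Hom n p} :
    f ∈ carrier m n → g ∈ carrier n p → P.comp f g ∈ carrier m p
  tensor_mem {m n m' n' : ℕ} {f : P.Hom m n} {g : P.Hom m' n'} :
    f ∈ carrier m n → g ∈ carrier m' n' → P.tensor f g ∈ carrier (m + m') (n + n')
  symm_mem (m n : ℕ) : P.symm m n ∈ carrier (m + n) (n + m)

/-- A sub-PROP, regarded as a PROP. -/
def SubPROP.toPROP {P : PROP.{u}} (S : SubPROP P) : PROP.{u} where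
  Hom m n := {f : P.Hom m n // f ∈ S.carrier m n}
  id n := ⟨P.id n, S.id_mem n⟩
  comp f g := ⟨P.comp f.1 g.1, S.comp_mem f.2 g.2⟩
  tensor f g := ⟨P.tensor f.1 g.1, S.tensor_mem f.2 g.2⟩
  symm m n := ⟨P.symm m n, S.symm_mem m n⟩
  id_comp f := Subtype.ext (P.id_comp f.1)
  comp_id f := Subtype.ext (P.comp_id f.1)
  comp_assoc f g h := Subtype.ext (P.comp_assoc f.1 g.1 h.1)
  tensor_id m n := Subtype.ext (P.tensor_id m n)
  tensor_comp f g f' g' := Subtype.ext (P.tensor_comp f.1 g.1 f'.1 g'.1)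
  tensor_assoc f g h := Subtype.ext <| by
    rw [castHom_map (H := fun m n => {f : P.Hom m n // f ∈ S.carrier m n}) (K := P.Hom)
      (fun f => f.1)]
    exact P.tensor_assoc f.1 g.1 h.1
  zero_tensor f := Subtype.ext <| by
    rw [castHom_map (H := fun m n => {f : P.Hom m n // f ∈ S.carrier m n}) (K := P.Hom)
      (fun f => f.1)]
    exact P.zero_tensor f.1
  tensor_zero f := Subtype.ext <| by
    rw [castHom_map (H := fun m n => {f : P.Hom m n // f ∈ S.carrier m n}) (K := P.Hom)
      (fun f => f.1)]
    exact P.tensor_zero f.1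
  symm_natural f g := Subtype.ext (P.symm_natural f.1 g.1)
  symm_symm m n := Subtype.ext (P.symm_symm m n)
  symm_hexagon m n p := Subtype.ext <| by
    have e := fun {m n m' n' : ℕ} (hm : m = m') (hn : n = n')
      (f : {f : P.Hom m n // f ∈ S.carrier m n}) =>
      castHom_map (H := fun m n => {f : P.Hom m n // f ∈ S.carrier m n}) (K := P.Hom)
      (fun f => f.1) hm hn f
    refine (e _ _ _).trans ((P.symm_hexagon m n p).trans ?_)
    exact congrArg (fun z => P.comp z (P.tensor (P.id n) (P.symm m p)))
      (e rfl (Nat.add_assoc n m p) ⟨P.tensor (P.symm m n) (P.id p), _⟩).symm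

/-- The quotient `P / ker F` of a PROP by the kernel congruence of a morphism of PROPs:
`f` and `g` become equal iff `F f = F g`. -/
def kerQuot {P : PROP.{u}} {Q : PROP.{v}} (F : PROPHom P Q) : PROP.{u} where
  Hom m n := Quotient (Setoid.ker (F.map : P.Hom m n → Q.Hom m n))
  id n := Quotient.mk _ (P.id n)
  comp f g := Quotient.map₂ P.comp (fun a b h c d k => by
    change F.map _ = F.map _ at *
    rw [F.map_comp, F.map_comp, h, k]) f g
  tensor f g := Quotient.map₂ P.tensor (fun a b h c d k => by
    change F.map _ = F.map _ at *
    rw [F.map_tensor, F.map_tensor, h, k]) f g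
  symm m n := Quotient.mk _ (P.symm m n)
  id_comp f := by
    induction f using Quotient.ind
    exact congrArg (Quotient.mk _) (P.id_comp _)
  comp_id f := by
    induction f using Quotient.ind
    exact congrArg (Quotient.mk _) (P.comp_id _)
  comp_assoc f g h := by
    induction f using Quotient.ind
    induction g using Quotient.ind
    induction h using Quotient.ind
    exact congrArg (Quotient.mk _) (P.comp_assoc _ _ _)
  tensor_id m n := congrArg (Quotient.mk _) (P.tensor_id m n)
  tensor_comp f g f' g' := by
    induction f using Quotient.ind
    induction g using Quotient.ind
    induction f' using Quotient.ind
    induction g' using Quotient.ind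
    exact congrArg (Quotient.mk _) (P.tensor_comp _ _ _ _)
  tensor_assoc f g h := by
    induction f using Quotient.ind
    induction g using Quotient.ind
    induction h using Quotient.ind
    exact (castHom_map (H := P.Hom) (fun {m n} f => Quotient.mk (Setoid.ker
      (F.map : P.Hom m n → Q.Hom m n)) f) _ _ _).symm.trans
      (congrArg (Quotient.mk _) (P.tensor_assoc _ _ _))
  zero_tensor f := by
    induction f using Quotient.ind
    exact (castHom_map (H := P.Hom) (fun {m n} f => Quotient.mk (Setoid.ker
      (F.map : P.Hom m n → Q.Hom m n)) f) _ _ _).symm.trans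
      (congrArg (Quotient.mk _) (P.zero_tensor _))
  tensor_zero f := by
    induction f using Quotient.ind
    exact (castHom_map (H := P.Hom) (fun {m n} f => Quotient.mk (Setoid.ker
      (F.map : P.Hom m n → Q.Hom m n)) f) _ _ _).symm.trans
      (congrArg (Quotient.mk _) (P.tensor_zero _))
  symm_natural f g := by
    induction f using Quotient.ind
    induction g using Quotient.ind
    exact congrArg (Quotient.mk _) (P.symm_natural _ _)
  symm_symm m n := congrArg (Quotient.mk _) (P.symm_symm m n)
  symm_hexagon m n p := by
    have e := fun {m n m' n' : ℕ} (hm : m = m') (hn : n = n') (f : P.Hom m n) =>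
      castHom_map (H := P.Hom) (fun {m n} f => Quotient.mk (Setoid.ker
      (F.map : P.Hom m n → Q.Hom m n)) f) hm hn f
    refine (e _ _ _).symm.trans ((congrArg (Quotient.mk _) (P.symm_hexagon m n p)).trans ?_)
    refine Eq.trans ?_ (congrArg (fun z => Quotient.map₂ P.comp _ z _) (e _ _ _))
    rfl

/-- The quotient projection `P → P / ker F`. -/
def kerQuot.proj {P : PROP.{u}} {Q : PROP.{v}} (F : PROPHom P Q) : PROPHom P (kerQuot F) where
  map f := Quotient.mk _ f
  map_id _ := rfl
  map_comp _ _ := rfl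
  map_tensor _ _ := rfl
  map_symm _ _ := rfl

/-! ### The PROP `Syn(δ)` of diagrams -/

/-- A wiring with `m` inputs, `n` outputs and a set `V` of internal vertices, each having one
incoming half-edge and an ordered pair (`false` = left, `true` = right) of outgoing half-edges.
The half-edges at which a wire starts are the inputs and the outgoing half-edges of vertices; the
half-edges at which a wire ends are the outputs and the incoming half-edges of vertices; a wiring
joins each of the former to exactly one of the latter, and conversely. -/
abbrev Wiring (m n : ℕ) (V : Type) : Type := (Fin m ⊕ V × Bool) ≃ (Fin n ⊕ V)

namespace Wiring

/-- No directed path leads from a vertex to itself. -/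
def Acyclic {m n : ℕ} {V : Type} (g : Wiring m n V) : Prop :=
  ∀ v : V, ¬ Relation.TransGen (fun a b => ∃ s, g (inr (a, s)) = inr b) v v

/-- The bijection `φ` of vertices preserves all wires; inputs and outputs are fixed. -/
def IsIso {m n : ℕ} {V W : Type} (g : Wiring m n V) (h : Wiring m n W) (φ : V ≃ W) : Prop :=
  (∀ i, h (inl i) = Sum.map _root_.id φ (g (inl i))) ∧
    ∀ v s, h (inr (φ v, s)) = Sum.map _root_.id φ (g (inr (v, s)))

/-- The vertex-free wiring given by a bijection from inputs to outputs. -/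
def ofEquiv {m n : ℕ} (e : Fin m ≃ Fin n) : Wiring m n Empty :=
  Equiv.sumCongr e (Equiv.equivOfIsEmpty _ _)

/-- Gluing the outputs of `g` to the inputs of `h`, in order. -/
def comp {m n p : ℕ} {V W : Type} (g : Wiring m n V) (h : Wiring n p W) :
    Wiring m p (V ⊕ W) :=
  calc (Fin m ⊕ (V ⊕ W) × Bool)
    _ ≃ Fin m ⊕ (V × Bool ⊕ W × Bool) :=
        Equiv.sumCongr (Equiv.refl _) (Equiv.sumProdDistrib _ _ _)
    _ ≃ (Fin m ⊕ V × Bool) ⊕ W × Bool := (Equiv.sumAssoc _ _ _).symm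
    _ ≃ (Fin n ⊕ V) ⊕ W × Bool := Equiv.sumCongr g (Equiv.refl _)
    _ ≃ (V ⊕ Fin n) ⊕ W × Bool := Equiv.sumCongr (Equiv.sumComm _ _) (Equiv.refl _)
    _ ≃ V ⊕ (Fin n ⊕ W × Bool) := Equiv.sumAssoc _ _ _
    _ ≃ V ⊕ (Fin p ⊕ W) := Equiv.sumCongr (Equiv.refl _) h
    _ ≃ (V ⊕ Fin p) ⊕ W := (Equiv.sumAssoc _ _ _).symm
    _ ≃ (Fin p ⊕ V) ⊕ W := Equiv.sumCongr (Equiv.sumComm _ _) (Equiv.refl _)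
    _ ≃ Fin p ⊕ (V ⊕ W) := Equiv.sumAssoc _ _ _

/-- Juxtaposition, with concatenated boundaries. -/
def tensor {m n m' n' : ℕ} {V W : Type} (g : Wiring m n V) (h : Wiring m' n' W) :
    Wiring (m + m') (n + n') (V ⊕ W) :=
  calc (Fin (m + m') ⊕ (V ⊕ W) × Bool)
    _ ≃ (Fin m ⊕ Fin m') ⊕ (V × Bool ⊕ W × Bool) :=
        Equiv.sumCongr finSumFinEquiv.symm (Equiv.sumProdDistrib _ _ _)
    _ ≃ (Fin m ⊕ V × Bool) ⊕ (Fin m' ⊕ W × Bool) := Equiv.sumSumSumComm _ _ _ _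
    _ ≃ (Fin n ⊕ V) ⊕ (Fin n' ⊕ W) := Equiv.sumCongr g h
    _ ≃ (Fin n ⊕ Fin n') ⊕ (V ⊕ W) := Equiv.sumSumSumComm _ _ _ _
    _ ≃ Fin (n + n') ⊕ (V ⊕ W) := Equiv.sumCongr finSumFinEquiv (Equiv.refl _)

/-- Continuation in the glued wiring of a wire of the first factor which ends at a given place. -/
def bridge {n p : ℕ} (V : Type) {W : Type} (h : Wiring n p W) :
    Fin n ⊕ V → Fin p ⊕ (V ⊕ W)
  | inl j => Sum.map _root_.id inr (h (inl j))
  | inr v => inr (inl v)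

section

variable {m n p m' n' p' q m'' n'' : ℕ} {U V W U' V' W' : Type}

theorem bridge_inl (h : Wiring n p W) (j : Fin n) :
    bridge V h (inl j) = Sum.map _root_.id inr (h (inl j)) := rfl

theorem bridge_inr (h : Wiring n p W) (v : V) : bridge V h (inr v) = inr (inl v) := rfl

theorem ofEquiv_inl (e : Fin m ≃ Fin n) (i : Fin m) : ofEquiv e (inl i) = inl (e i) := rfl

theorem comp_inl (g : Wiring m n V) (h : Wiring n p W) (i : Fin m) :
    comp g h (inl i) = bridge V h (g (inl i)) := by
  simp only [comp, Trans.trans, Equiv.trans_apply]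
  rcases h₁ : g (inl i) with j | v
  · rcases h' : h (inl j) with k | w <;> simp [bridge, h₁, h']
  · simp [bridge, h₁]

theorem comp_inr_inl (g : Wiring m n V) (h : Wiring n p W) (v : V) (s : Bool) :
    comp g h (inr (inl v, s)) = bridge V h (g (inr (v, s))) := by
  simp only [comp, Trans.trans, Equiv.trans_apply]
  rcases h₁ : g (inr (v, s)) with j | v
  · rcases h' : h (inl j) with k | w <;> simp [bridge, h₁, h']
  · simp [bridge, h₁]

theorem comp_inr_inr (g : Wiring m n V) (h : Wiring n p W) (w : W) (s : Bool) :
    comp g h (inr (inr w, s)) = Sum.map _root_.id inr (h (inr (w, s))) := by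
  simp only [comp, Trans.trans, Equiv.trans_apply]
  rcases h₁ : h (inr (w, s)) with j | v <;> simp [h₁]

theorem tensor_castAdd (g : Wiring m n V) (h : Wiring m' n' W) (i : Fin m) :
    tensor g h (inl (Fin.castAdd m' i)) = Sum.map (Fin.castAdd n') inl (g (inl i)) := by
  simp only [tensor, Trans.trans, Equiv.trans_apply]
  rcases h₁ : g (inl i) with j | v <;> simp [h₁]

theorem tensor_natAdd (g : Wiring m n V) (h : Wiring m' n' W) (i : Fin m') :
    tensor g h (inl (Fin.natAdd m i)) = Sum.map (Fin.natAdd n) inr (h (inl i)) := by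
  simp only [tensor, Trans.trans, Equiv.trans_apply]
  rcases h₁ : h (inl i) with j | v <;> simp [h₁]

theorem tensor_inr_inl (g : Wiring m n V) (h : Wiring m' n' W) (v : V) (s : Bool) :
    tensor g h (inr (inl v, s)) = Sum.map (Fin.castAdd n') inl (g (inr (v, s))) := by
  simp only [tensor, Trans.trans, Equiv.trans_apply]
  rcases h₁ : g (inr (v, s)) with j | v <;> simp [h₁]

theorem tensor_inr_inr (g : Wiring m n V) (h : Wiring m' n' W) (w : W) (s : Bool) :
    tensor g h (inr (inr w, s)) = Sum.map (Fin.natAdd n) inr (h (inr (w, s))) := by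
  simp only [tensor, Trans.trans, Equiv.trans_apply]
  rcases h₁ : h (inr (w, s)) with j | v <;> simp [h₁]

theorem acyclic_sum {α β : Type} {r : α ⊕ β → α ⊕ β → Prop} {ra : α → α → Prop}
    {rb : β → β → Prop} (ha : ∀ a, ¬ Relation.TransGen ra a a)
    (hb : ∀ b, ¬ Relation.TransGen rb b b)
    (haa : ∀ a a', r (inl a) (inl a') → ra a a')
    (hbb : ∀ b b', r (inr b) (inr b') → rb b b')
    (hba : ∀ b a, ¬ r (inr b) (inl a)) (x : α ⊕ β) : ¬ Relation.TransGen r x x := by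
  have key : ∀ x y, Relation.TransGen r x y →
      (∀ a' : α, y = inl a' → ∃ a, x = inl a ∧ Relation.TransGen ra a a') ∧
      (∀ b : β, x = inr b → ∃ b', y = inr b' ∧ Relation.TransGen rb b b') := by
    intro x y h
    induction h with
    | @single y h =>
      constructor
      · rintro a' rfl
        rcases x with a | b
        · exact ⟨a, rfl, .single (haa _ _ h)⟩
        · exact (hba _ _ h).elim
      · rintro b rfl
        rcases y with a | b'
        · exact (hba _ _ h).elim
        · exact ⟨b', rfl, .single (hbb _ _ h)⟩
    | @tail y z _ h ih =>
      constructor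
      · rintro a' rfl
        rcases y with a | b
        · obtain ⟨a₀, rfl, h₀⟩ := ih.1 a rfl
          exact ⟨a₀, rfl, h₀.tail (haa _ _ h)⟩
        · exact (hba _ _ h).elim
      · rintro b rfl
        obtain ⟨b', rfl, h₀⟩ := ih.2 b rfl
        rcases z with a | c
        · exact (hba _ _ h).elim
        · exact ⟨c, rfl, h₀.tail (hbb _ _ h)⟩
  intro h
  rcases x with a | b
  · obtain ⟨a', e, h'⟩ := (key _ _ h).1 a rfl
    cases e
    exact ha _ h'
  · obtain ⟨b', e, h'⟩ := (key _ _ h).2 b rfl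
    cases e
    exact hb _ h'

theorem Acyclic.comp {g : Wiring m n V} {h : Wiring n p W} (hg : g.Acyclic) (hh : h.Acyclic) :
    (g.comp h).Acyclic := by
  apply acyclic_sum hg hh
  · rintro a a' ⟨s, h₁⟩
    refine ⟨s, ?_⟩
    rw [comp_inr_inl] at h₁
    rcases e : g (inr (a, s)) with j | v
    · rcases e' : h (inl j) with k | w <;> simp [e, e', bridge] at h₁
    · simpa [e, bridge] using h₁
  · rintro a a' ⟨s, h₁⟩
    refine ⟨s, ?_⟩
    rw [comp_inr_inr] at h₁
    rcases e : h (inr (a, s)) with j | v <;> simp [e] at h₁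
    rw [h₁]
  · rintro b a ⟨s, h₁⟩
    rw [comp_inr_inr] at h₁
    rcases e : h (inr (b, s)) with j | v <;> simp [e] at h₁

theorem Acyclic.tensor {g : Wiring m n V} {h : Wiring m' n' W} (hg : g.Acyclic)
    (hh : h.Acyclic) : (g.tensor h).Acyclic := by
  apply acyclic_sum hg hh
  · rintro a a' ⟨s, h₁⟩
    refine ⟨s, ?_⟩
    rw [tensor_inr_inl] at h₁
    rcases e : g (inr (a, s)) with j | v <;> simp [e] at h₁
    rw [h₁]
  · rintro a a' ⟨s, h₁⟩
    refine ⟨s, ?_⟩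
    rw [tensor_inr_inr] at h₁
    rcases e : h (inr (a, s)) with j | v <;> simp [e] at h₁
    rw [h₁]
  · rintro b a ⟨s, h₁⟩
    rw [tensor_inr_inr] at h₁
    rcases e : h (inr (b, s)) with j | v <;> simp [e] at h₁

theorem IsIso.refl (g : Wiring m n V) : IsIso g g (Equiv.refl V) := by
  constructor
  · intro i
    rcases h : g (inl i) with j | w <;> simp
  · intro v s
    rcases h : g (inr (v, s)) with j | w <;> simp [h]

theorem IsIso.symm {g : Wiring m n V} {h : Wiring m n W} {φ : V ≃ W} (H : IsIso g h φ) :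
    IsIso h g φ.symm := by
  constructor
  · intro i
    rw [H.1]
    rcases g (inl i) with j | w <;> simp
  · intro v s
    obtain ⟨v, rfl⟩ := φ.surjective v
    rw [H.2, Equiv.symm_apply_apply]
    rcases g (inr (v, s)) with j | w <;> simp

theorem IsIso.trans {g : Wiring m n U} {h : Wiring m n V} {k : Wiring m n W} {φ : U ≃ V}
    {ψ : V ≃ W} (H : IsIso g h φ) (K : IsIso h k ψ) : IsIso g k (φ.trans ψ) := by
  constructor
  · intro i
    rw [K.1, H.1]
    rcases g (inl i) with j | w <;> simp
  · intro v s
    rw [Equiv.trans_apply, K.2, H.2]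
    rcases g (inr (v, s)) with j | w <;> simp

theorem IsIso.comp {g : Wiring m n V} {g' : Wiring m n V'} {h : Wiring n p W}
    {h' : Wiring n p W'} {φ : V ≃ V'} {ψ : W ≃ W'} (H : IsIso g g' φ) (K : IsIso h h' ψ) :
    IsIso (g.comp h) (g'.comp h') (Equiv.sumCongr φ ψ) := by
  refine ⟨fun i => ?_, fun v s => ?_⟩
  · rw [comp_inl, comp_inl, H.1]
    rcases g (inl i) with j | v
    · simp only [Sum.map_inl, bridge_inl, _root_.id, K.1]
      rcases h (inl j) with _ | _ <;> simp
    · simp [bridge_inr]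
  rcases v with v | w
  · rw [Equiv.sumCongr_apply, Sum.map_inl, comp_inr_inl, comp_inr_inl, H.2]
    rcases g (inr (v, s)) with j | v
    · simp only [Sum.map_inl, bridge_inl, _root_.id, K.1]
      rcases h (inl j) with _ | _ <;> simp
    · simp [bridge_inr]
  · rw [Equiv.sumCongr_apply, Sum.map_inr, comp_inr_inr, comp_inr_inr, K.2]
    rcases h (inr (w, s)) with j | v <;> simp

theorem IsIso.tensor {g : Wiring m n V} {g' : Wiring m n V'} {h : Wiring m' n' W}
    {h' : Wiring m' n' W'} {φ : V ≃ V'} {ψ : W ≃ W'} (H : IsIso g g' φ) (K : IsIso h h' ψ) :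
    IsIso (g.tensor h) (g'.tensor h') (Equiv.sumCongr φ ψ) := by
  refine ⟨fun i => ?_, fun v s => ?_⟩
  · induction i using Fin.addCases with
    | left i =>
      rw [tensor_castAdd, tensor_castAdd, H.1]
      rcases g (inl i) with _ | _ <;> simp
    | right i =>
      rw [tensor_natAdd, tensor_natAdd, K.1]
      rcases h (inl i) with _ | _ <;> simp
  rcases v with v | w
  · rw [Equiv.sumCongr_apply, Sum.map_inl, tensor_inr_inl, tensor_inr_inl, H.2]
    rcases g (inr (v, s)) with _ | _ <;> simp
  · rw [Equiv.sumCongr_apply, Sum.map_inr, tensor_inr_inr, tensor_inr_inr, K.2]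
    rcases h (inr (w, s)) with _ | _ <;> simp

theorem ofEquiv_comp_isIso (e : Fin m ≃ Fin n) (g : Wiring n p V) (k : Wiring m p W)
    (φ : V ≃ W) (h₁ : ∀ i, k (inl i) = Sum.map _root_.id φ (g (inl (e i))))
    (h₂ : ∀ v s, k (inr (φ v, s)) = Sum.map _root_.id φ (g (inr (v, s)))) :
    IsIso ((ofEquiv e).comp g) k ((Equiv.emptySum Empty V).trans φ) := by
  refine ⟨fun i => ?_, fun v s => ?_⟩
  · rw [comp_inl, ofEquiv_inl, h₁, bridge_inl]
    rcases h : g (inl (e i)) with _ | _ <;> simp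
  rcases v with v | w
  · exact v.elim
  · rw [comp_inr_inr, Equiv.trans_apply, Equiv.emptySum_apply_inr, h₂]
    rcases h : g (inr (w, s)) with _ | _ <;> simp

theorem comp_ofEquiv_isIso (e : Fin n ≃ Fin p) (g : Wiring m n V) (k : Wiring m p W)
    (φ : V ≃ W) (h₁ : ∀ i, k (inl i) = Sum.map e φ (g (inl i)))
    (h₂ : ∀ v s, k (inr (φ v, s)) = Sum.map e φ (g (inr (v, s)))) :
    IsIso (g.comp (ofEquiv e)) k ((Equiv.sumEmpty V Empty).trans φ) := by
  refine ⟨fun i => ?_, fun v s => ?_⟩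
  · rw [comp_inl, h₁]
    rcases h : g (inl i) with _ | _ <;> simp [bridge, ofEquiv_inl]
  rcases v with v | w
  · rw [comp_inr_inl, Equiv.trans_apply, Equiv.sumEmpty_apply_inl, h₂]
    rcases h : g (inr (v, s)) with _ | _ <;> simp [bridge, ofEquiv_inl]
  · exact w.elim

theorem comp_assoc (f : Wiring m n U) (g : Wiring n p V) (h : Wiring p q W) :
    IsIso ((f.comp g).comp h) (f.comp (g.comp h)) (Equiv.sumAssoc U V W) := by
  refine ⟨fun i => ?_, fun v s => ?_⟩
  · simp only [comp_inl]
    rcases f (inl i) with j | u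
    · simp only [bridge_inl, comp_inl]
      rcases g (inl j) with k | v
      · simp only [bridge_inl, Sum.map_inl, _root_.id]
        rcases h (inl k) with l | w <;> simp
      · simp [bridge]
    · simp [bridge]
  rcases v with (u | v) | w
  · simp only [Equiv.sumAssoc_apply_inl_inl, comp_inr_inl]
    rcases f (inr (u, s)) with j | u
    · simp only [bridge_inl, comp_inl]
      rcases g (inl j) with k | v
      · simp only [bridge_inl, Sum.map_inl, _root_.id]
        rcases h (inl k) with l | w <;> simp
      · simp [bridge]
    · simp [bridge]
  · simp only [Equiv.sumAssoc_apply_inl_inr, comp_inr_inl, comp_inr_inr]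
    rcases g (inr (v, s)) with k | v
    · simp only [bridge_inl, Sum.map_inl, _root_.id]
      rcases h (inl k) with l | w <;> simp
    · simp [bridge]
  · simp only [Equiv.sumAssoc_apply_inr, comp_inr_inr]
    rcases h (inr (w, s)) with k | v <;> simp

theorem tensor_ofEquiv (e : Fin m ≃ Fin n) (e' : Fin m' ≃ Fin n')
    (e'' : Fin (m + m') ≃ Fin (n + n'))
    (h : ∀ i, e'' (Fin.castAdd m' i) = Fin.castAdd n' (e i))
    (h' : ∀ i, e'' (Fin.natAdd m i) = Fin.natAdd n (e' i)) :
    IsIso ((ofEquiv e).tensor (ofEquiv e')) (ofEquiv e'') (Equiv.emptySum Empty Empty) := by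
  refine ⟨fun i => ?_, fun v => ?_⟩
  · induction i using Fin.addCases with
    | left i => simp [tensor_castAdd, ofEquiv_inl, h]
    | right i => simp [tensor_natAdd, ofEquiv_inl, h']
  · rcases v with v | v <;> exact v.elim

theorem tensor_comp (f : Wiring m n U) (g : Wiring n p V) (f' : Wiring m' n' U')
    (g' : Wiring n' p' V') :
    IsIso ((f.comp g).tensor (f'.comp g')) ((f.tensor f').comp (g.tensor g'))
      (Equiv.sumSumSumComm U V U' V') := by
  refine ⟨fun i => ?_, fun v s => ?_⟩
  · induction i using Fin.addCases with
    | left i =>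
      rw [tensor_castAdd, comp_inl, comp_inl, tensor_castAdd]
      rcases f (inl i) with j | u
      · simp only [bridge_inl, Sum.map_inl, tensor_castAdd]
        rcases g (inl j) with k | v <;> simp
      · simp [bridge]
    | right i =>
      rw [tensor_natAdd, comp_inl, comp_inl, tensor_natAdd]
      rcases f' (inl i) with j | u
      · simp only [bridge_inl, Sum.map_inl, tensor_natAdd]
        rcases g' (inl j) with k | v <;> simp
      · simp [bridge]
  rcases v with (u | v) | (u | v)
  · change ((f.tensor f').comp (g.tensor g')) (inr (inl (inl u), s)) = _
    rw [comp_inr_inl, tensor_inr_inl, tensor_inr_inl, comp_inr_inl]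
    rcases f (inr (u, s)) with j | u
    · simp only [bridge_inl, Sum.map_inl, tensor_castAdd]
      rcases g (inl j) with k | v <;> simp
    · simp [bridge]
  · change ((f.tensor f').comp (g.tensor g')) (inr (inr (inl v), s)) = _
    rw [comp_inr_inr, tensor_inr_inl, tensor_inr_inl, comp_inr_inr]
    rcases g (inr (v, s)) with j | u <;> simp
  · change ((f.tensor f').comp (g.tensor g')) (inr (inl (inr u), s)) = _
    rw [comp_inr_inl, tensor_inr_inr, tensor_inr_inr, comp_inr_inl]
    rcases f' (inr (u, s)) with j | u
    · simp only [bridge_inl, Sum.map_inl, tensor_natAdd]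
      rcases g' (inl j) with k | v <;> simp
    · simp [bridge]
  · change ((f.tensor f').comp (g.tensor g')) (inr (inr (inr v), s)) = _
    rw [comp_inr_inr, tensor_inr_inr, tensor_inr_inr, comp_inr_inr]
    rcases g' (inr (v, s)) with j | u <;> simp

theorem cast_castAdd_castAdd (i : Fin m) (h : m + m' + m'' = m + (m' + m'')) :
    Fin.cast h (Fin.castAdd m'' (Fin.castAdd m' i)) = Fin.castAdd (m' + m'') i := rfl

theorem cast_castAdd_natAdd (i : Fin m') (h : m + m' + m'' = m + (m' + m'')) :
    Fin.cast h (Fin.castAdd m'' (Fin.natAdd m i)) = Fin.natAdd m (Fin.castAdd m'' i) := rfl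

theorem cast_natAdd (i : Fin m'') (h : m + m' + m'' = m + (m' + m'')) :
    Fin.cast h (Fin.natAdd (m + m') i) = Fin.natAdd m (Fin.natAdd m' i) :=
  Fin.ext (Nat.add_assoc _ _ _)

theorem tensor_assoc (f : Wiring m n U) (g : Wiring m' n' V) (h : Wiring m'' n'' W) :
    (∀ i, (f.tensor (g.tensor h)) (inl (Fin.cast (Nat.add_assoc m m' m'') i)) =
      Sum.map (Fin.cast (Nat.add_assoc n n' n'')) (Equiv.sumAssoc U V W)
        (((f.tensor g).tensor h) (inl i))) ∧
    ∀ v s, (f.tensor (g.tensor h)) (inr (Equiv.sumAssoc U V W v, s)) =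
      Sum.map (Fin.cast (Nat.add_assoc n n' n'')) (Equiv.sumAssoc U V W)
        (((f.tensor g).tensor h) (inr (v, s))) := by
  refine ⟨fun i => ?_, fun v s => ?_⟩
  · induction i using Fin.addCases with
    | left i =>
      induction i using Fin.addCases with
      | left i =>
        rw [cast_castAdd_castAdd, tensor_castAdd, tensor_castAdd, tensor_castAdd]
        rcases f (inl i) with j | u
        · simp only [Sum.map_inl, cast_castAdd_castAdd]
        · simp
      | right i =>
        rw [cast_castAdd_natAdd, tensor_natAdd, tensor_castAdd, tensor_castAdd, tensor_natAdd]
        rcases g (inl i) with j | u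
        · simp only [Sum.map_inl, cast_castAdd_natAdd]
        · simp
    | right i =>
      rw [cast_natAdd, tensor_natAdd, tensor_natAdd, tensor_natAdd]
      rcases h (inl i) with j | u
      · simp only [Sum.map_inl, cast_natAdd]
      · simp
  rcases v with (u | v) | w
  · rw [Equiv.sumAssoc_apply_inl_inl, tensor_inr_inl, tensor_inr_inl, tensor_inr_inl]
    rcases f (inr (u, s)) with j | u
    · simp only [Sum.map_inl, cast_castAdd_castAdd]
    · simp
  · rw [Equiv.sumAssoc_apply_inl_inr, tensor_inr_inl, tensor_inr_inr, tensor_inr_inl,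
      tensor_inr_inr]
    rcases g (inr (v, s)) with j | u
    · simp only [Sum.map_inl, cast_castAdd_natAdd]
    · simp
  · rw [Equiv.sumAssoc_apply_inr, tensor_inr_inr, tensor_inr_inr, tensor_inr_inr]
    rcases h (inr (w, s)) with j | u
    · simp only [Sum.map_inl, cast_natAdd]
    · simp

theorem cast_natAdd_zero (i : Fin m) : Fin.cast (Nat.zero_add m) (Fin.natAdd 0 i) = i :=
  Fin.ext (Nat.zero_add _)

theorem zero_tensor (f : Wiring m n U) :
    (∀ i, f (inl (Fin.cast (Nat.zero_add m) i)) =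
      Sum.map (Fin.cast (Nat.zero_add n)) (Equiv.emptySum Empty U)
        (((ofEquiv (Equiv.refl (Fin 0))).tensor f) (inl i))) ∧
    ∀ v s, f (inr (Equiv.emptySum Empty U v, s)) =
      Sum.map (Fin.cast (Nat.zero_add n)) (Equiv.emptySum Empty U)
        (((ofEquiv (Equiv.refl (Fin 0))).tensor f) (inr (v, s))) := by
  refine ⟨fun i => ?_, fun v s => ?_⟩
  · induction i using Fin.addCases with
    | left i => exact i.elim0
    | right i =>
      rw [tensor_natAdd, cast_natAdd_zero]
      rcases f (inl i) with j | u
      · simp only [Sum.map_inl, cast_natAdd_zero]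
      · simp
  rcases v with v | v
  · exact v.elim
  · rw [tensor_inr_inr, Equiv.emptySum_apply_inr]
    rcases f (inr (v, s)) with j | u
    · simp only [Sum.map_inl, cast_natAdd_zero]
    · simp

theorem tensor_zero (f : Wiring m n U) :
    IsIso (f.tensor (ofEquiv (Equiv.refl (Fin 0)))) f (Equiv.sumEmpty U Empty) := by
  refine ⟨fun i => ?_, fun v s => ?_⟩
  · induction i using Fin.addCases with
    | left i =>
      rw [tensor_castAdd]
      change f (inl i) = _
      rcases f (inl i) with j | u <;> simp [Fin.castAdd]
    | right i => exact i.elim0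
  rcases v with v | v
  · rw [tensor_inr_inl, Equiv.sumEmpty_apply_inl]
    rcases f (inr (v, s)) with j | u <;> simp [Fin.castAdd]
  · exact v.elim

theorem symm_natural (f : Wiring m n U) (g : Wiring m' n' V) :
    IsIso ((ofEquiv finAddFlip).comp (g.tensor f)) ((f.tensor g).comp (ofEquiv finAddFlip))
      ((Equiv.emptySum Empty _).trans
        ((Equiv.sumComm V U).trans (Equiv.sumEmpty (U ⊕ V) Empty).symm)) := by
  refine ofEquiv_comp_isIso _ _ _ _ (fun i => ?_) (fun v s => ?_)
  · induction i using Fin.addCases with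
    | left i =>
      rw [comp_inl, tensor_castAdd, finAddFlip_apply_castAdd, tensor_natAdd]
      rcases f (inl i) with j | u <;> simp [bridge, ofEquiv_inl]
    | right i =>
      rw [comp_inl, tensor_natAdd, finAddFlip_apply_natAdd, tensor_castAdd]
      rcases g (inl i) with j | u <;> simp [bridge, ofEquiv_inl]
  rcases v with v | v
  · change ((f.tensor g).comp _) (inr (inl (inr v), s)) = _
    rw [comp_inr_inl, tensor_inr_inr, tensor_inr_inl]
    rcases g (inr (v, s)) with j | u <;> simp [bridge, ofEquiv_inl]
  · change ((f.tensor g).comp _) (inr (inl (inl v), s)) = _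
    rw [comp_inr_inl, tensor_inr_inr, tensor_inr_inl]
    rcases f (inr (v, s)) with j | u <;> simp [bridge, ofEquiv_inl]

theorem ofEquiv_comp_ofEquiv (e : Fin m ≃ Fin n) (e' : Fin n ≃ Fin p) :
    IsIso ((ofEquiv e).comp (ofEquiv e')) (ofEquiv (e.trans e'))
      ((Equiv.emptySum Empty Empty).trans (Equiv.refl Empty)) :=
  ofEquiv_comp_isIso _ _ _ (Equiv.refl Empty) (fun _ => rfl) (fun v => v.elim)

/-- The hexagon identity for block transpositions, as an identity of permutations. -/
theorem finAddFlip_hexagon (i : Fin (m + n + p)) :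
    Fin.cast (Nat.add_assoc n p m) (finAddFlip (Fin.cast (Nat.add_assoc m n p) i)) =
      finSumFinEquiv (Sum.map _root_.id finAddFlip (finSumFinEquiv.symm
        (Fin.cast (Nat.add_assoc n m p) (finSumFinEquiv
          (Sum.map finAddFlip _root_.id (finSumFinEquiv.symm i)))))) := by
  induction i using Fin.addCases with
  | left i =>
    induction i using Fin.addCases with
    | left i =>
      rw [cast_castAdd_castAdd, finAddFlip_apply_castAdd, cast_natAdd]
      simp [cast_castAdd_natAdd]
    | right i =>
      rw [cast_castAdd_natAdd, finAddFlip_apply_natAdd, cast_castAdd_castAdd]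
      simp only [finSumFinEquiv_symm_apply_castAdd, Sum.map_inl, finAddFlip_apply_natAdd,
        finSumFinEquiv_apply_left, cast_castAdd_castAdd, _root_.id]
  | right i =>
    rw [cast_natAdd, finAddFlip_apply_natAdd, cast_castAdd_natAdd]
    simp only [finSumFinEquiv_symm_apply_natAdd, Sum.map_inr, finAddFlip_apply_natAdd,
        finSumFinEquiv_apply_right, cast_natAdd, _root_.id]

end

end Wiring

/-- A finite directed acyclic graph with `m` ordered input half-edges, `n` ordered output
half-edges and finitely many internal vertices, each with one incoming half-edge and an ordered
pair of outgoing half-edges. -/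
structure Diagram (m n : ℕ) : Type 1 where
  V : Type
  finite : Finite V
  wire : Wiring m n V
  acyclic : wire.Acyclic

namespace Diagram

/-- Diagrams are isomorphic if some bijection of internal vertices preserves all wires, with
their positions at the inputs, at the outputs and at the vertices. -/
def Iso {m n : ℕ} (G H : Diagram m n) : Prop :=
  ∃ φ : G.V ≃ H.V, G.wire.IsIso H.wire φ

/-- Isomorphism of diagrams, as an equivalence relation. -/
def isoSetoid (m n : ℕ) : Setoid (Diagram m n) where
  r := Iso
  iseqv :=
    { refl := fun G => ⟨_, Wiring.IsIso.refl G.wire⟩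
      symm := fun ⟨_, h⟩ => ⟨_, h.symm⟩
      trans := fun ⟨_, h⟩ ⟨_, k⟩ => ⟨_, h.trans k⟩ }

/-- The vertex-free diagram given by a bijection from inputs to outputs. -/
def ofEquiv {m n : ℕ} (e : Fin m ≃ Fin n) : Diagram m n where
  V := Empty
  finite := inferInstance
  wire := Wiring.ofEquiv e
  acyclic v := v.elim

/-- Composition: gluing of the outputs of `G` to the inputs of `H`. -/
def comp {m n p : ℕ} (G : Diagram m n) (H : Diagram n p) : Diagram m p where
  V := G.V ⊕ H.V
  finite := by
    have := G.finite
    have := H.finite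
    infer_instance
  wire := G.wire.comp H.wire
  acyclic := G.acyclic.comp H.acyclic

/-- Tensor: disjoint union, with concatenated boundaries. -/
def tensor {m n m' n' : ℕ} (G : Diagram m n) (H : Diagram m' n') :
    Diagram (m + m') (n + n') where
  V := G.V ⊕ H.V
  finite := by
    have := G.finite
    have := H.finite
    infer_instance
  wire := G.wire.tensor H.wire
  acyclic := G.acyclic.tensor H.acyclic

/-- The diagram `1 → 2` with exactly one internal vertex `v`: the input is joined to `v`, the
left outgoing half-edge of `v` to the first output and the right one to the second output. -/
def delta : Diagram 1 2 where
  V := Unit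
  finite := inferInstance
  wire :=
    { toFun := Sum.elim (fun _ => inr ()) (fun x => inl (bif x.2 then 1 else 0))
      invFun := Sum.elim (fun j => inr ((), j == 1)) (fun _ => inl 0)
      left_inv := by
        rintro (i | ⟨_, _ | _⟩)
        · simp [Subsingleton.elim i 0]
        · simp
        · simp
      right_inv := by
        rintro (j | v)
        · fin_cases j <;> simp
        · rfl }
  acyclic v h := by
    cases h with
    | single h => exact absurd h (by simp)
    | tail _ h => exact absurd h (by simp)

theorem comp_congr {m n p : ℕ} {G G' : Diagram m n} {H H' : Diagram n p} :
    Iso G G' → Iso H H' → Iso (G.comp H) (G'.comp H') :=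
  fun ⟨_, h⟩ ⟨_, k⟩ => ⟨_, h.comp k⟩

theorem tensor_congr {m n m' n' : ℕ} {G G' : Diagram m n} {H H' : Diagram m' n'} :
    Iso G G' → Iso H H' → Iso (G.tensor H) (G'.tensor H') :=
  fun ⟨_, h⟩ ⟨_, k⟩ => ⟨_, h.tensor k⟩

theorem ofEquiv_comp_ofEquiv {m n p : ℕ} (e : Fin m ≃ Fin n) (e' : Fin n ≃ Fin p) :
    Iso ((ofEquiv e).comp (ofEquiv e')) (ofEquiv (e.trans e')) :=
  ⟨_, Wiring.ofEquiv_comp_ofEquiv e e'⟩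

theorem castHom_iso {m n m' n' : ℕ} (hm : m = m') (hn : n = n') (G : Diagram m n)
    (K : Diagram m' n') (φ : G.V ≃ K.V)
    (h : (∀ i, K.wire (inl (Fin.cast hm i)) = Sum.map (Fin.cast hn) φ (G.wire (inl i))) ∧
      ∀ v s, K.wire (inr (φ v, s)) = Sum.map (Fin.cast hn) φ (G.wire (inr (v, s)))) :
    Iso (castHom hm hn G) K := by
  subst hm hn
  exact ⟨φ, h⟩

/-- Composition of isomorphism classes of diagrams. -/
def qcomp {m n p : ℕ} (f : Quotient (isoSetoid m n)) (g : Quotient (isoSetoid n p)) :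
    Quotient (isoSetoid m p) :=
  Quotient.map₂ comp (fun _ _ (h : Iso _ _) _ _ (k : Iso _ _) => comp_congr h k) f g

/-- Tensor of isomorphism classes of diagrams. -/
def qtensor {m n m' n' : ℕ} (f : Quotient (isoSetoid m n)) (g : Quotient (isoSetoid m' n')) :
    Quotient (isoSetoid (m + m') (n + n')) :=
  Quotient.map₂ tensor (fun _ _ (h : Iso _ _) _ _ (k : Iso _ _) => tensor_congr h k) f g

theorem qcomp_mk {m n p : ℕ} (G : Diagram m n) (H : Diagram n p) :
    qcomp (Quotient.mk _ G) (Quotient.mk _ H) = Quotient.mk _ (G.comp H) := rfl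

theorem qtensor_mk {m n m' n' : ℕ} (G : Diagram m n) (H : Diagram m' n') :
    qtensor (Quotient.mk _ G) (Quotient.mk _ H) = Quotient.mk _ (G.tensor H) := rfl

theorem mk_ofEquiv_comp {m n p : ℕ} (e : Fin m ≃ Fin n) (e' : Fin n ≃ Fin p) :
    Quotient.mk (isoSetoid m p) ((ofEquiv e).comp (ofEquiv e')) =
      Quotient.mk (isoSetoid m p) (ofEquiv (e.trans e')) :=
  Quotient.sound (ofEquiv_comp_ofEquiv e e')

theorem castHom_mk_ofEquiv {m n m' n' : ℕ} (hm : m = m') (hn : n = n') (e : Fin m ≃ Fin n) :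
    castHom (H := fun m n => Quotient (isoSetoid m n)) hm hn (Quotient.mk _ (ofEquiv e)) =
      Quotient.mk _ (ofEquiv (((finCongr hm).symm.trans e).trans (finCongr hn))) := by
  subst hm hn
  rfl

theorem castHom_mk_tensor {a b c d a' b' : ℕ} (ha : a + c = a') (hb : b + d = b')
    (u : Fin a ≃ Fin b) (w : Fin c ≃ Fin d) :
    castHom (H := fun m n => Quotient (isoSetoid m n)) ha hb
      (Quotient.mk _ ((ofEquiv u).tensor (ofEquiv w))) =
    Quotient.mk _ (ofEquiv (((finCongr ha).symm.trans
      ((finSumFinEquiv.symm.trans (Equiv.sumCongr u w)).trans finSumFinEquiv)).trans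
        (finCongr hb))) := by
  subst ha hb
  exact Quotient.sound
    ⟨_, Wiring.tensor_ofEquiv _ _ _ (fun _ => by simp) (fun _ => by simp)⟩

theorem mk_symm_symm (m n : ℕ) :
    qcomp (Quotient.mk _ (ofEquiv (finAddFlip (m := m) (n := n))))
      (Quotient.mk _ (ofEquiv finAddFlip)) =
    Quotient.mk (isoSetoid (m + n) (m + n)) (ofEquiv (Equiv.refl _)) := by
  rw [qcomp_mk, mk_ofEquiv_comp]
  congr 2
  ext i
  induction i using Fin.addCases <;> simp

theorem mk_symm_natural {m n m' n' : ℕ} (F : Diagram m n) (G : Diagram m' n') :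
    qcomp (qtensor (Quotient.mk _ F) (Quotient.mk _ G)) (Quotient.mk _ (ofEquiv finAddFlip)) =
      qcomp (Quotient.mk _ (ofEquiv finAddFlip))
        (qtensor (Quotient.mk _ G) (Quotient.mk _ F)) := by
  rw [qtensor_mk, qtensor_mk, qcomp_mk, qcomp_mk]
  symm
  exact Quotient.sound (s := isoSetoid (m + m') (n' + n))
    (⟨_, Wiring.symm_natural F.wire G.wire⟩ : Iso _ _)

theorem mk_symm_hexagon (m n p : ℕ) :
    castHom (H := fun m n => Quotient (isoSetoid m n)) (Nat.add_assoc m n p).symm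
      (Nat.add_assoc n p m) (Quotient.mk _ (ofEquiv finAddFlip)) =
    qcomp
      (castHom (H := fun m n => Quotient (isoSetoid m n)) rfl (Nat.add_assoc n m p)
        (qtensor (Quotient.mk _ (ofEquiv finAddFlip)) (Quotient.mk _ (ofEquiv (Equiv.refl (Fin p))))))
      (qtensor (Quotient.mk _ (ofEquiv (Equiv.refl (Fin n)))) (Quotient.mk _ (ofEquiv finAddFlip))) := by
  have k := castHom_mk_tensor rfl rfl (Equiv.refl (Fin n)) (finAddFlip (m := m) (n := p))
  rw [show ∀ {a b : ℕ} (x : Quotient (isoSetoid a b)),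
    castHom (H := fun m n => Quotient (isoSetoid m n)) rfl rfl x = x from fun _ => rfl] at k
  rw [qtensor_mk, qtensor_mk, castHom_mk_ofEquiv, castHom_mk_tensor, k, qcomp_mk, mk_ofEquiv_comp]
  congr 2
  ext i : 1
  exact Wiring.finAddFlip_hexagon i

end Diagram

/-- The PROP `Syn(δ)`: morphisms `m → n` are isomorphism classes of diagrams. -/
def Syn : PROP.{1} where
  Hom m n := Quotient (Diagram.isoSetoid m n)
  id n := Quotient.mk _ (Diagram.ofEquiv (Equiv.refl (Fin n)))
  comp f g := Diagram.qcomp f g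
  tensor f g := Diagram.qtensor f g
  symm m n := Quotient.mk _ (Diagram.ofEquiv finAddFlip)
  id_comp f := by
    induction f using Quotient.ind
    exact Quotient.sound ⟨_, Wiring.ofEquiv_comp_isIso _ _ _ (Equiv.refl _) (fun _ => by simp)
      (fun _ _ => by simp)⟩
  comp_id f := by
    induction f using Quotient.ind
    exact Quotient.sound ⟨_, Wiring.comp_ofEquiv_isIso _ _ _ (Equiv.refl _) (fun _ => by simp)
      (fun _ _ => by simp)⟩
  comp_assoc f g h := by
    induction f using Quotient.ind
    induction g using Quotient.ind
    induction h using Quotient.ind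
    exact Quotient.sound ⟨_, Wiring.comp_assoc _ _ _⟩
  tensor_id m n := Quotient.sound
    ⟨_, Wiring.tensor_ofEquiv _ _ _ (fun _ => rfl) (fun _ => rfl)⟩
  tensor_comp f g f' g' := by
    induction f using Quotient.ind
    induction g using Quotient.ind
    induction f' using Quotient.ind
    induction g' using Quotient.ind
    exact Quotient.sound ⟨_, Wiring.tensor_comp _ _ _ _⟩
  tensor_assoc f g h := by
    induction f using Quotient.ind
    induction g using Quotient.ind
    induction h using Quotient.ind
    exact (castHom_map (H := Diagram) (fun {m n} f => Quotient.mk (Diagram.isoSetoid m n) f)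
      _ _ _).symm.trans (Quotient.sound
        (Diagram.castHom_iso _ _ _ _ _ (Wiring.tensor_assoc _ _ _)))
  zero_tensor f := by
    induction f using Quotient.ind
    exact (castHom_map (H := Diagram) (fun {m n} f => Quotient.mk (Diagram.isoSetoid m n) f)
      _ _ _).symm.trans (Quotient.sound
        (Diagram.castHom_iso _ _ _ _ _ (Wiring.zero_tensor _)))
  tensor_zero f := by
    induction f using Quotient.ind
    exact Quotient.sound ⟨_, Wiring.tensor_zero _⟩
  symm_natural f g := by
    induction f using Quotient.ind
    induction g using Quotient.ind
    exact Diagram.mk_symm_natural _ _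
  symm_symm m n := Diagram.mk_symm_symm m n
  symm_hexagon m n p := Diagram.mk_symm_hexagon m n p

/-- The generator `δ : 1 → 2` of `Syn(δ)`. -/
def Syn.delta : Syn.Hom 1 2 := Quotient.mk _ Diagram.delta

/-! ### The PROP `FinCorel` of finite corelations -/

/-- Corelations `m → n`: equivalence relations on `{1, …, m} ⊔ {1, …, n}`. -/
abbrev Corel (m n : ℕ) : Type := Setoid (Fin m ⊕ Fin n)

namespace Corel

/-- The union of two corelations, as a relation on `{1, …, m} ⊔ {1, …, n} ⊔ {1, …, p}`. -/
inductive Glue {m n p : ℕ} (R : Corel m n) (S : Corel n p) :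
    Fin m ⊕ (Fin n ⊕ Fin p) → Fin m ⊕ (Fin n ⊕ Fin p) → Prop
  | left {x y : Fin m ⊕ Fin n} (h : R x y) : Glue R S (Sum.map id inl x) (Sum.map id inl y)
  | right {x y : Fin n ⊕ Fin p} (h : S x y) : Glue R S (inr x) (inr y)

/-- Composition of corelations: the restriction to the outer boundary of the equivalence relation
generated by the union (which is its transitive closure, the union being already reflexive and
symmetric). -/
@[reducible] def comp {m n p : ℕ} (R : Corel m n) (S : Corel n p) : Corel m p :=
  (Relation.EqvGen.setoid (Glue R S)).comap (Sum.map id inr)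

/-- The disjoint union of two equivalence relations. -/
@[reducible] def sumSetoid {α β : Type} (R : Setoid α) (S : Setoid β) : Setoid (α ⊕ β) where
  r := Sum.LiftRel R S
  iseqv :=
    { refl := by
        rintro (x | x)
        · exact .inl (R.refl x)
        · exact .inr (S.refl x)
      symm := by
        rintro _ _ (h | h)
        · exact .inl (R.symm h)
        · exact .inr (S.symm h)
      trans := by
        rintro _ _ _ (h | h) (k | k)
        · exact .inl (R.trans h k)
        · exact .inr (S.trans h k) }

/-- Sorting the boundary elements of a tensor product into the two blocks. -/
def split (m n m' n' : ℕ) :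
    Fin (m + m') ⊕ Fin (n + n') ≃ (Fin m ⊕ Fin n) ⊕ (Fin m' ⊕ Fin n') :=
  (Equiv.sumCongr finSumFinEquiv.symm finSumFinEquiv.symm).trans (Equiv.sumSumSumComm _ _ _ _)

/-- Tensor of corelations: disjoint union with reindexing. -/
@[reducible] def tensor {m n m' n' : ℕ} (R : Corel m n) (S : Corel m' n') : Corel (m + m') (n + n') :=
  (sumSetoid R S).comap (split m n m' n')

/-- The corelation of a bijection `e`: input `i` is equivalent exactly to itself and to output
`e i`. -/
@[reducible] def ofEquiv {m n : ℕ} (e : Fin m ≃ Fin n) : Corel m n := Setoid.ker (Sum.elim e id)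

/-- The functions `a`, `b` are constant on the classes of `R`. -/
def Sat {m n : ℕ} {Z : Type} (R : Corel m n) (a : Fin m → Z) (b : Fin n → Z) : Prop :=
  ∀ x y, R x y → Sum.elim a b x = Sum.elim a b y

section

variable {m n p q m' n' p' m'' n'' : ℕ} {Z Z' : Type}

theorem ext_sat {R S : Corel m n}
    (h : ∀ (Z : Type) (a : Fin m → Z) (b : Fin n → Z), Sat R a b ↔ Sat S a b) : R = S := by
  have key : ∀ {R S : Corel m n}, (∀ (Z : Type) (a : Fin m → Z) (b : Fin n → Z),
      Sat S a b → Sat R a b) → R ≤ S := by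
    intro R S h x y hxy
    have := h (Quotient S) (fun i => Quotient.mk S (inl i)) (fun j => Quotient.mk S (inr j))
      (by rintro (x | x) (y | y) k <;> exact Quotient.sound k) x y hxy
    rcases x with x | x <;> rcases y with y | y <;> exact Quotient.exact this
  exact le_antisymm (key fun Z a b => (h Z a b).2) (key fun Z a b => (h Z a b).1)

theorem sat_inj {R : Corel m n} {ι : Z → Z'} (hι : Function.Injective ι) (a : Fin m → Z)
    (b : Fin n → Z) : Sat R (ι ∘ a) (ι ∘ b) ↔ Sat R a b := by
  have e : ∀ x, Sum.elim (ι ∘ a) (ι ∘ b) x = ι (Sum.elim a b x) := by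
    rintro (x | x) <;> rfl
  simp only [Sat, e, hι.eq_iff]

theorem sat_comp {R : Corel m n} {S : Corel n p} {a : Fin m → Z} {b : Fin n → Z}
    {c : Fin p → Z} (hR : Sat R a b) (hS : Sat S b c) : Sat (comp R S) a c := by
  have key : ∀ x y, Relation.EqvGen (Glue R S) x y →
      Sum.elim a (Sum.elim b c) x = Sum.elim a (Sum.elim b c) y := by
    intro x y h
    induction h with
    | rel x y h =>
      rcases h with h | h
      · rename_i x y
        have := hR x y h
        rcases x with x | x <;> rcases y with y | y <;> exact this
      · exact hS _ _ h
    | refl => rfl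
    | symm _ _ _ ih => exact ih.symm
    | trans _ _ _ _ _ ih ih' => exact ih.trans ih'
  intro x y h
  have := key _ _ h
  rcases x with x | x <;> rcases y with y | y <;> exact this

theorem exists_of_sat_comp {R : Corel m n} {S : Corel n p} {a : Fin m → Z} {c : Fin p → Z}
    (h : Sat (comp R S) a c) :
    ∃ b : Fin n → Option Z, Sat R (some ∘ a) b ∧ Sat S b (some ∘ c) := by
  classical
  let E := Relation.EqvGen.setoid (Glue R S)
  let P : (Fin m ⊕ Fin p → Prop) → Option Z := fun q =>
    if k : ∃ x, q x then some (Sum.elim a c k.choose) else none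
  let F : Fin m ⊕ (Fin n ⊕ Fin p) → Option Z := fun t => P fun x => E (Sum.map id inr x) t
  have hF : ∀ s t, E s t → F s = F t := by
    intro s t hst
    have e : (fun x : Fin m ⊕ Fin p => E (Sum.map id inr x) s) =
        fun x : Fin m ⊕ Fin p => E (Sum.map id inr x) t :=
      funext fun x => propext ⟨fun k => E.trans k hst, fun k => E.trans k (E.symm hst)⟩
    exact congrArg P e
  have hF' : ∀ x, F (Sum.map id inr x) = some (Sum.elim a c x) := by
    intro x
    have k : ∃ y : Fin m ⊕ Fin p, E (Sum.map id inr y) (Sum.map id inr x) := ⟨x, E.refl _⟩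
    simp only [F, P]
    rw [dif_pos k]
    exact congrArg some (h _ _ k.choose_spec)
  refine ⟨fun j => F (inr (inl j)), ?_, ?_⟩
  · have e : ∀ x, Sum.elim (some ∘ a) (fun j => F (inr (inl j))) x = F (Sum.map id inl x) := by
      rintro (x | x)
      · exact (hF' (inl x)).symm
      · rfl
    intro x y hxy
    rw [e, e]
    exact hF _ _ (.rel _ _ (.left hxy))
  · have e : ∀ x, Sum.elim (fun j => F (inr (inl j))) (some ∘ c) x = F (inr x) := by
      rintro (x | x)
      · rfl
      · exact (hF' (inr x)).symm
    intro x y hxy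
    rw [e, e]
    exact hF _ _ (.rel _ _ (.right hxy))

theorem sat_comp_of_inj {R : Corel m n} {S : Corel n p} {a : Fin m → Z} {b : Fin n → Z'}
    {c : Fin p → Z} {ι : Z → Z'} (hι : Function.Injective ι) (hR : Sat R (ι ∘ a) b)
    (hS : Sat S b (ι ∘ c)) : Sat (comp R S) a c :=
  (sat_inj hι a c).1 (sat_comp hR hS)

theorem sat_tensor {R : Corel m n} {S : Corel m' n'} {a : Fin (m + m') → Z}
    {b : Fin (n + n') → Z} :
    Sat (tensor R S) a b ↔ Sat R (fun i => a (Fin.castAdd m' i)) (fun j => b (Fin.castAdd n' j)) ∧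
      Sat S (fun i => a (Fin.natAdd m i)) (fun j => b (Fin.natAdd n j)) := by
  have e₁ : ∀ x, Sum.elim (fun i => a (Fin.castAdd m' i)) (fun j => b (Fin.castAdd n' j)) x =
      Sum.elim a b ((split m n m' n').symm (inl x)) := by
    rintro (x | x) <;> simp [split]
  have e₂ : ∀ x, Sum.elim (fun i => a (Fin.natAdd m i)) (fun j => b (Fin.natAdd n j)) x =
      Sum.elim a b ((split m n m' n').symm (inr x)) := by
    rintro (x | x) <;> simp [split]
  have h : Sat (tensor R S) a b ↔ ∀ x y, Sum.LiftRel R S x y →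
      Sum.elim a b ((split m n m' n').symm x) = Sum.elim a b ((split m n m' n').symm y) := by
    constructor
    · intro H x y hxy
      refine H _ _ ?_
      change Sum.LiftRel R S (split m n m' n' _) (split m n m' n' _)
      simpa using hxy
    · intro H x y hxy
      have := H _ _ (show Sum.LiftRel R S (split m n m' n' x) (split m n m' n' y) from hxy)
      simpa using this
  rw [h]
  constructor
  · intro H
    refine ⟨fun x y hxy => ?_, fun x y hxy => ?_⟩
    · rw [e₁, e₁]
      exact H _ _ (.inl hxy)
    · rw [e₂, e₂]
      exact H _ _ (.inr hxy)
  · rintro ⟨H₁, H₂⟩ _ _ (hxy | hxy)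
    · rw [← e₁, ← e₁]
      exact H₁ _ _ hxy
    · rw [← e₂, ← e₂]
      exact H₂ _ _ hxy

theorem sat_ofEquiv {e : Fin m ≃ Fin n} {a : Fin m → Z} {b : Fin n → Z} :
    Sat (ofEquiv e) a b ↔ ∀ i, a i = b (e i) := by
  constructor
  · intro H i
    exact H (inl i) (inr (e i)) rfl
  · intro H x y hxy
    have k : ∀ x, Sum.elim a b x = b (Sum.elim e id x) := by
      rintro (x | x)
      · exact H x
      · rfl
    rw [k, k]
    exact congrArg b hxy

theorem sat_castHom (hm : m = m') (hn : n = n') {R : Corel m n} {a : Fin m' → Z}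
    {b : Fin n' → Z} :
    Sat (castHom (H := Corel) hm hn R) a b ↔
      Sat R (fun i => a (Fin.cast hm i)) (fun j => b (Fin.cast hn j)) := by
  subst hm hn
  rfl

theorem sat_ofEquiv_comp {e : Fin m ≃ Fin n} {R : Corel n p} {a : Fin m → Z} {c : Fin p → Z} :
    Sat (comp (ofEquiv e) R) a c ↔ Sat R (fun i => a (e.symm i)) c := by
  constructor
  · intro H
    obtain ⟨b, h₁, h₂⟩ := exists_of_sat_comp H
    rw [sat_ofEquiv] at h₁
    refine (sat_inj (Option.some_injective Z) _ _).1 ?_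
    convert h₂ using 1
    ext1 i
    simpa using h₁ (e.symm i)
  · intro H
    exact sat_comp (sat_ofEquiv.2 fun i => by simp) H

theorem sat_comp_ofEquiv {e : Fin n ≃ Fin p} {R : Corel m n} {a : Fin m → Z} {c : Fin p → Z} :
    Sat (comp R (ofEquiv e)) a c ↔ Sat R a (fun j => c (e j)) := by
  constructor
  · intro H
    obtain ⟨b, h₁, h₂⟩ := exists_of_sat_comp H
    rw [sat_ofEquiv] at h₂
    refine (sat_inj (Option.some_injective Z) _ _).1 ?_
    convert h₁ using 1
    ext1 i
    exact (h₂ i).symm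
  · intro H
    exact sat_comp H (sat_ofEquiv.2 fun i => rfl)

theorem castHom_ofEquiv (hm : m = m') (hn : n = n') (e : Fin m ≃ Fin n) :
    castHom (H := Corel) hm hn (ofEquiv e) =
      ofEquiv (((finCongr hm).symm.trans e).trans (finCongr hn)) := by
  subst hm hn
  rfl

theorem ofEquiv_comp_ofEquiv (e : Fin m ≃ Fin n) (e' : Fin n ≃ Fin p) :
    comp (ofEquiv e) (ofEquiv e') = ofEquiv (e.trans e') :=
  ext_sat fun Z a b => by
    rw [sat_comp_ofEquiv, sat_ofEquiv, sat_ofEquiv]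
    rfl

theorem tensor_ofEquiv (e : Fin m ≃ Fin n) (e' : Fin m' ≃ Fin n') :
    tensor (ofEquiv e) (ofEquiv e') =
      ofEquiv ((finSumFinEquiv.symm.trans (Equiv.sumCongr e e')).trans finSumFinEquiv) :=
  ext_sat fun Z a b => by
    rw [sat_tensor, sat_ofEquiv, sat_ofEquiv, sat_ofEquiv]
    constructor
    · rintro ⟨h, h'⟩ i
      induction i using Fin.addCases with
      | left i => simpa using h i
      | right i => simpa using h' i
    · intro h
      exact ⟨fun i => by simpa using h (Fin.castAdd m' i),
        fun i => by simpa using h (Fin.natAdd m i)⟩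

theorem tensor_sat_addCases {R : Corel m n} {S : Corel m' n'} {a : Fin (m + m') → Z}
    {b₁ : Fin n → Z} {b₂ : Fin n' → Z} (h₁ : Sat R (fun i => a (Fin.castAdd m' i)) b₁)
    (h₂ : Sat S (fun i => a (Fin.natAdd m i)) b₂) :
    Sat (tensor R S) a (Fin.addCases b₁ b₂) := by
  refine sat_tensor.2 ⟨?_, ?_⟩
  · simpa only [Fin.addCases_left] using h₁
  · simpa only [Fin.addCases_right] using h₂

theorem tensor_sat_addCases' {R : Corel m n} {S : Corel m' n'} {a₁ : Fin m → Z}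
    {a₂ : Fin m' → Z} {b : Fin (n + n') → Z} (h₁ : Sat R a₁ (fun i => b (Fin.castAdd n' i)))
    (h₂ : Sat S a₂ (fun i => b (Fin.natAdd n i))) :
    Sat (tensor R S) (Fin.addCases a₁ a₂) b := by
  refine sat_tensor.2 ⟨?_, ?_⟩
  · simpa only [Fin.addCases_left] using h₁
  · simpa only [Fin.addCases_right] using h₂

end

end Corel

open Corel in
/-- The PROP `FinCorel` of finite corelations. -/
def FinCorel : PROP.{0} where
  Hom := Corel
  id n := ofEquiv (Equiv.refl (Fin n))
  comp := Corel.comp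
  tensor := Corel.tensor
  symm m n := ofEquiv finAddFlip
  id_comp R := ext_sat fun Z a c => sat_ofEquiv_comp
  comp_id R := ext_sat fun Z a c => sat_comp_ofEquiv
  comp_assoc R S T := ext_sat fun Z a d => by
    constructor
    · intro H
      obtain ⟨c, h₁, h₂⟩ := exists_of_sat_comp H
      obtain ⟨b, h₃, h₄⟩ := exists_of_sat_comp h₁
      have hi : Function.Injective (some ∘ some : Z → Option (Option Z)) :=
        (Option.some_injective _).comp (Option.some_injective _)
      exact sat_comp_of_inj hi h₃
        (sat_comp h₄ ((sat_inj (Option.some_injective _) _ _).2 h₂))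
    · intro H
      obtain ⟨b, h₁, h₂⟩ := exists_of_sat_comp H
      obtain ⟨c, h₃, h₄⟩ := exists_of_sat_comp h₂
      have hi : Function.Injective (some ∘ some : Z → Option (Option Z)) :=
        (Option.some_injective _).comp (Option.some_injective _)
      exact sat_comp_of_inj hi
        (sat_comp ((sat_inj (Option.some_injective _) _ _).2 h₁) h₃) h₄
  tensor_id m n := ext_sat fun Z a b => by
    rw [sat_tensor, sat_ofEquiv, sat_ofEquiv, sat_ofEquiv]
    exact ⟨fun h i => Fin.addCases h.1 h.2 i, fun h => ⟨fun i => h _, fun i => h _⟩⟩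
  tensor_comp R S R' S' := ext_sat fun Z a c => by
    constructor
    · intro H
      obtain ⟨h, h'⟩ := sat_tensor.1 H
      obtain ⟨b, h₁, h₂⟩ := exists_of_sat_comp h
      obtain ⟨b', h₁', h₂'⟩ := exists_of_sat_comp h'
      exact sat_comp_of_inj (Option.some_injective _)
        (tensor_sat_addCases (a := some ∘ a) h₁ h₁') (tensor_sat_addCases' (b := some ∘ c) h₂ h₂')
    · intro H
      obtain ⟨b, h₁, h₂⟩ := exists_of_sat_comp H
      obtain ⟨h₃, h₃'⟩ := sat_tensor.1 h₁
      obtain ⟨h₄, h₄'⟩ := sat_tensor.1 h₂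
      exact sat_tensor.2 ⟨sat_comp_of_inj (Option.some_injective _) h₃ h₄,
        sat_comp_of_inj (Option.some_injective _) h₃' h₄'⟩
  tensor_assoc R S T := ext_sat fun Z a b => by
    rw [sat_castHom]
    simp only [sat_tensor, Wiring.cast_natAdd, Wiring.cast_castAdd_castAdd,
      Wiring.cast_castAdd_natAdd, and_assoc]
  zero_tensor R := ext_sat fun Z a b => by
    rw [sat_castHom, sat_tensor, sat_ofEquiv]
    simp only [Wiring.cast_natAdd_zero]
    exact ⟨fun h => h.2, fun h => ⟨fun i => i.elim0, h⟩⟩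
  tensor_zero R := ext_sat fun Z a b => by
    rw [sat_castHom, sat_tensor, sat_ofEquiv]
    exact ⟨fun h => h.1, fun h => ⟨h, fun i => i.elim0⟩⟩
  symm_natural R S := ext_sat fun Z a b => by
    rw [sat_comp_ofEquiv, sat_ofEquiv_comp, sat_tensor, sat_tensor]
    have h₁ : ∀ {k l : ℕ} (i : Fin l), (finAddFlip (m := k) (n := l)).symm (Fin.castAdd k i) =
        Fin.natAdd k i := fun i => (Equiv.symm_apply_eq _).2 (finAddFlip_apply_natAdd i _).symm
    have h₂ : ∀ {k l : ℕ} (i : Fin k), (finAddFlip (m := k) (n := l)).symm (Fin.natAdd l i) =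
        Fin.castAdd l i := fun i => (Equiv.symm_apply_eq _).2 (finAddFlip_apply_castAdd i _).symm
    simp only [h₁, h₂, finAddFlip_apply_castAdd, finAddFlip_apply_natAdd]
    exact and_comm
  symm_symm m n := ext_sat fun Z a b => by
    rw [sat_comp_ofEquiv, sat_ofEquiv, sat_ofEquiv]
    refine forall_congr' fun i => ?_
    have : finAddFlip (finAddFlip i) = i := by
      induction i using Fin.addCases <;> simp
    rw [this]
    rfl
  symm_hexagon m n p := by
    have k := castHom_ofEquiv rfl (Nat.add_assoc n m p) ((finSumFinEquiv.symm.trans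
      (Equiv.sumCongr (finAddFlip (m := m) (n := n)) (Equiv.refl (Fin p)))).trans finSumFinEquiv)
    rw [castHom_ofEquiv, tensor_ofEquiv, tensor_ofEquiv, k, ofEquiv_comp_ofEquiv]
    congr 1
    ext1 i
    exact Wiring.finAddFlip_hexagon i

/-- The defining condition of `FinCorel°`: (a) every equivalence class contains exactly one input
element, and (b) every equivalence class contains at least one output element. -/
def Corel.IsCirc {m n : ℕ} (R : Corel m n) : Prop :=
  (∀ c ∈ R.classes, ∃! i : Fin m, inl i ∈ c) ∧ (∀ c ∈ R.classes, ∃ j : Fin n, inr j ∈ c)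

/-! ### The ancestry partition -/

namespace Diagram

variable {m n : ℕ}

/-- The node of the underlying undirected graph at which a wire starts: an input pendant vertex or
an internal vertex. -/
def srcNode (G : Diagram m n) : Fin m ⊕ G.V × Bool → (Fin m ⊕ Fin n) ⊕ G.V
  | inl i => inl (inl i)
  | inr (v, _) => inr v

/-- The node of the underlying undirected graph at which a wire ends: an output pendant vertex or
an internal vertex. -/
def tgtNode (G : Diagram m n) : Fin n ⊕ G.V → (Fin m ⊕ Fin n) ⊕ G.V
  | inl j => inl (inr j)
  | inr v => inr v

/-- The underlying undirected graph `|G|`, whose nodes are the inputs and outputs (as pendant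
vertices) and the internal vertices, and whose edges are the wires. -/
def underlying (G : Diagram m n) : SimpleGraph ((Fin m ⊕ Fin n) ⊕ G.V) :=
  SimpleGraph.fromRel fun x y => ∃ s, G.srcNode s = x ∧ G.tgtNode (G.wire s) = y

/-- The ancestry partition: two boundary elements are equivalent if their pendant vertices lie in
the same connected component of the underlying undirected graph. -/
@[reducible] def ancestry (G : Diagram m n) : Corel m n :=
  G.underlying.reachableSetoid.comap inl

theorem Iso.ancestry_le {G H : Diagram m n} (h : Iso G H) : G.ancestry ≤ H.ancestry := by
  obtain ⟨φ, h₁, h₂⟩ := h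
  let F : (Fin m ⊕ Fin n) ⊕ G.V → (Fin m ⊕ Fin n) ⊕ H.V := Sum.map id φ
  have hF : Function.Injective F := Function.injective_id.sumMap φ.injective
  have hr : ∀ x y, (∃ s, G.srcNode s = x ∧ G.tgtNode (G.wire s) = y) →
      ∃ s, H.srcNode s = F x ∧ H.tgtNode (H.wire s) = F y := by
    rintro _ _ ⟨i | ⟨v, s⟩, rfl, rfl⟩
    · refine ⟨inl i, rfl, ?_⟩
      rw [h₁]
      rcases G.wire (inl i) with j | v <;> rfl
    · refine ⟨inr (φ v, s), rfl, ?_⟩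
      rw [h₂]
      rcases G.wire (inr (v, s)) with j | v <;> rfl
  let f : G.underlying →g H.underlying :=
    { toFun := F
      map_rel' := fun {x y} hxy => by
        obtain ⟨hne, hxy⟩ := (SimpleGraph.fromRel_adj _ _ _).1 hxy
        exact (SimpleGraph.fromRel_adj _ _ _).2 ⟨hF.ne hne, hxy.imp (hr _ _) (hr _ _)⟩ }
  intro x y hxy
  exact SimpleGraph.Reachable.map f hxy

theorem Iso.ancestry_eq {G H : Diagram m n} (h : Iso G H) : G.ancestry = H.ancestry :=
  le_antisymm h.ancestry_le (Iso.ancestry_le ((isoSetoid m n).symm h))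

end Diagram

/-- The ancestry partition of a morphism of `Syn(δ)`. -/
def ancestry {m n : ℕ} (f : Syn.Hom m n) : FinCorel.Hom m n :=
  Quotient.lift Diagram.ancestry (fun _ _ h => Diagram.Iso.ancestry_eq h) f

/-! ### The PROP `Cocom` -/

/-- Formal composites and tensors of identities, symmetries and one generator `δ : 1 → 2`. -/
inductive Term : ℕ → ℕ → Type
  | id (n : ℕ) : Term n n
  | comp {m n p : ℕ} (f : Term m n) (g : Term n p) : Term m p
  | tensor {m n m' n' : ℕ} (f : Term m n) (g : Term m' n') : Term (m + m') (n + n')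
  | symm (m n : ℕ) : Term (m + n) (n + m)
  | delta : Term 1 2

/-- The least congruence on terms which contains the axioms of a PROP, coassociativity and
cocommutativity of `δ`. -/
inductive CocomRel : ∀ {m n : ℕ}, Term m n → Term m n → Prop
  | refl {m n : ℕ} (f : Term m n) : CocomRel f f
  | symm {m n : ℕ} {f g : Term m n} : CocomRel f g → CocomRel g f
  | trans {m n : ℕ} {f g h : Term m n} : CocomRel f g → CocomRel g h → CocomRel f h
  | comp_congr {m n p : ℕ} {f f' : Term m n} {g g' : Term n p} :
    CocomRel f f' → CocomRel g g' → CocomRel (f.comp g) (f'.comp g')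
  | tensor_congr {m n m' n' : ℕ} {f f' : Term m n} {g g' : Term m' n'} :
    CocomRel f f' → CocomRel g g' → CocomRel (f.tensor g) (f'.tensor g')
  | id_comp {m n : ℕ} (f : Term m n) : CocomRel ((Term.id m).comp f) f
  | comp_id {m n : ℕ} (f : Term m n) : CocomRel (f.comp (Term.id n)) f
  | comp_assoc {m n p q : ℕ} (f : Term m n) (g : Term n p) (h : Term p q) :
    CocomRel ((f.comp g).comp h) (f.comp (g.comp h))
  | tensor_id (m n : ℕ) : CocomRel ((Term.id m).tensor (Term.id n)) (Term.id (m + n))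
  | tensor_comp {m n p m' n' p' : ℕ} (f : Term m n) (g : Term n p) (f' : Term m' n')
    (g' : Term n' p') :
    CocomRel ((f.comp g).tensor (f'.comp g')) ((f.tensor f').comp (g.tensor g'))
  | tensor_assoc {m n m' n' m'' n'' : ℕ} (f : Term m n) (g : Term m' n') (h : Term m'' n'') :
    CocomRel (castHom (Nat.add_assoc m m' m'') (Nat.add_assoc n n' n'')
      ((f.tensor g).tensor h)) (f.tensor (g.tensor h))
  | zero_tensor {m n : ℕ} (f : Term m n) :
    CocomRel (castHom (Nat.zero_add m) (Nat.zero_add n) ((Term.id 0).tensor f)) f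
  | tensor_zero {m n : ℕ} (f : Term m n) :
    CocomRel (castHom (Nat.add_zero m) (Nat.add_zero n) (f.tensor (Term.id 0))) f
  | symm_natural {m n m' n' : ℕ} (f : Term m n) (g : Term m' n') :
    CocomRel ((f.tensor g).comp (Term.symm n n')) ((Term.symm m m').comp (g.tensor f))
  | symm_symm (m n : ℕ) :
    CocomRel ((Term.symm m n).comp (Term.symm n m)) (Term.id (m + n))
  | symm_hexagon (m n p : ℕ) :
    CocomRel (castHom (Nat.add_assoc m n p).symm (Nat.add_assoc n p m) (Term.symm m (n + p)))
      ((castHom rfl (Nat.add_assoc n m p) ((Term.symm m n).tensor (Term.id p))).comp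
        ((Term.id n).tensor (Term.symm m p)))
  | coassoc : CocomRel (Term.delta.comp (Term.delta.tensor (Term.id 1)))
      (Term.delta.comp ((Term.id 1).tensor Term.delta))
  | cocomm : CocomRel (Term.delta.comp (Term.symm 1 1)) Term.delta

/-- Provable equality of terms, as an equivalence relation. -/
def cocomSetoid (m n : ℕ) : Setoid (Term m n) where
  r := CocomRel
  iseqv := ⟨.refl, .symm, .trans⟩

theorem castHom_mk_term {m n m' n' : ℕ} (hm : m = m') (hn : n = n') (f : Term m n) :
    castHom (H := fun m n => Quotient (cocomSetoid m n)) hm hn (Quotient.mk _ f) =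
      Quotient.mk _ (castHom hm hn f) := by
  subst hm hn
  rfl

/-- The PROP `Cocom` freely generated by a morphism `δ : 1 → 2` subject to coassociativity and
cocommutativity. -/
def Cocom : PROP.{0} where
  Hom m n := Quotient (cocomSetoid m n)
  id n := Quotient.mk _ (Term.id n)
  comp f g := Quotient.map₂ Term.comp (fun _ _ h _ _ k => CocomRel.comp_congr h k) f g
  tensor f g := Quotient.map₂ Term.tensor (fun _ _ h _ _ k => CocomRel.tensor_congr h k) f g
  symm m n := Quotient.mk _ (Term.symm m n)
  id_comp f := by
    induction f using Quotient.ind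
    exact Quotient.sound (CocomRel.id_comp _)
  comp_id f := by
    induction f using Quotient.ind
    exact Quotient.sound (CocomRel.comp_id _)
  comp_assoc f g h := by
    induction f using Quotient.ind
    induction g using Quotient.ind
    induction h using Quotient.ind
    exact Quotient.sound (CocomRel.comp_assoc _ _ _)
  tensor_id m n := Quotient.sound (CocomRel.tensor_id m n)
  tensor_comp f g f' g' := by
    induction f using Quotient.ind
    induction g using Quotient.ind
    induction f' using Quotient.ind
    induction g' using Quotient.ind
    exact Quotient.sound (CocomRel.tensor_comp _ _ _ _)
  tensor_assoc f g h := by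
    induction f using Quotient.ind
    induction g using Quotient.ind
    induction h using Quotient.ind
    exact (castHom_mk_term _ _ _).trans (Quotient.sound (CocomRel.tensor_assoc _ _ _))
  zero_tensor f := by
    induction f using Quotient.ind
    exact (castHom_mk_term _ _ _).trans (Quotient.sound (CocomRel.zero_tensor _))
  tensor_zero f := by
    induction f using Quotient.ind
    exact (castHom_mk_term _ _ _).trans (Quotient.sound (CocomRel.tensor_zero _))
  symm_natural f g := by
    induction f using Quotient.ind
    induction g using Quotient.ind
    exact Quotient.sound (CocomRel.symm_natural _ _)
  symm_symm m n := Quotient.sound (CocomRel.symm_symm m n)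
  symm_hexagon m n p := by
    have k := castHom_mk_term rfl (Nat.add_assoc n m p) ((Term.symm m n).tensor (Term.id p))
    refine (castHom_mk_term _ _ _).trans ((Quotient.sound (CocomRel.symm_hexagon m n p)).trans ?_)
    exact congrArg (fun z => Quotient.map₂ Term.comp
      (fun _ _ h _ _ k => CocomRel.comp_congr h k) z
      (Quotient.mk _ ((Term.id n).tensor (Term.symm m p)))) k.symm

/-- The generator `δ : 1 → 2` of `Cocom`. -/
def Cocom.delta : Cocom.Hom 1 2 := Quotient.mk _ Term.delta

/-! ### The PROP of surjections -/

theorem castHom_surj {m n m' n' : ℕ} (hm : m = m') (hn : n = n')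
    (φ : {φ : Fin n → Fin m // Function.Surjective φ}) (j : Fin n') :
    (castHom (H := fun m n => {φ : Fin n → Fin m // Function.Surjective φ}) hm hn φ).1 j =
      Fin.cast hm (φ.1 (Fin.cast hn.symm j)) := by
  subst hm hn
  rfl

/-- The tensor of two functions between finite ordinals. -/
def finSumMap {m n m' n' : ℕ} (φ : Fin n → Fin m) (ψ : Fin n' → Fin m') :
    Fin (n + n') → Fin (m + m') :=
  finSumFinEquiv ∘ Sum.map φ ψ ∘ finSumFinEquiv.symm

theorem finSumMap_castAdd {m n m' n' : ℕ} (φ : Fin n → Fin m) (ψ : Fin n' → Fin m')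
    (j : Fin n) : finSumMap φ ψ (Fin.castAdd n' j) = Fin.castAdd m' (φ j) := by
  simp [finSumMap]

theorem finSumMap_natAdd {m n m' n' : ℕ} (φ : Fin n → Fin m) (ψ : Fin n' → Fin m')
    (j : Fin n') : finSumMap φ ψ (Fin.natAdd n j) = Fin.natAdd m (ψ j) := by
  simp [finSumMap]

theorem finSumMap_surjective {m n m' n' : ℕ} {φ : Fin n → Fin m} {ψ : Fin n' → Fin m'}
    (hφ : Function.Surjective φ) (hψ : Function.Surjective ψ) :
    Function.Surjective (finSumMap φ ψ) :=
  finSumFinEquiv.surjective.comp ((hφ.sumMap hψ).comp finSumFinEquiv.symm.surjective)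

theorem surj_hexagon (m n p : ℕ) (j : Fin (n + p + m)) :
    Fin.cast (Nat.add_assoc m n p).symm (finAddFlip j) =
      finSumMap finAddFlip id (Fin.cast (Nat.add_assoc n m p).symm
        (finSumMap id finAddFlip (Fin.cast (Nat.add_assoc n p m) j))) := by
  have h₁ : ∀ {a b c : ℕ} (i : Fin a), Fin.cast (Nat.add_assoc a b c).symm
      (Fin.castAdd (b + c) i) = Fin.castAdd c (Fin.castAdd b i) := fun _ => rfl
  have h₂ : ∀ {a b c : ℕ} (i : Fin b), Fin.cast (Nat.add_assoc a b c).symm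
      (Fin.natAdd a (Fin.castAdd c i)) = Fin.castAdd c (Fin.natAdd a i) := fun _ => rfl
  have h₃ : ∀ {a b c : ℕ} (i : Fin c), Fin.cast (Nat.add_assoc a b c).symm
      (Fin.natAdd a (Fin.natAdd b i)) = Fin.natAdd (a + b) i :=
    fun _ => Fin.ext (Nat.add_assoc _ _ _).symm
  induction j using Fin.addCases with
  | left j =>
    induction j using Fin.addCases with
    | left j =>
      rw [Wiring.cast_castAdd_castAdd, finAddFlip_apply_castAdd, h₂, finSumMap_castAdd, id, h₁,
        finSumMap_castAdd, finAddFlip_apply_castAdd]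
    | right j =>
      rw [Wiring.cast_castAdd_natAdd, finAddFlip_apply_castAdd, h₃, finSumMap_natAdd,
        finAddFlip_apply_castAdd, h₃, finSumMap_natAdd, id]
  | right j =>
    rw [Wiring.cast_natAdd, finAddFlip_apply_natAdd, h₁, finSumMap_natAdd,
      finAddFlip_apply_natAdd, h₂, finSumMap_castAdd, finAddFlip_apply_natAdd]

/-- The PROP whose morphisms `m → n` are the surjections `{1, …, n} → {1, …, m}`, composed as
functions, with disjoint union as tensor. -/
def SurjOp : PROP.{0} where
  Hom m n := {φ : Fin n → Fin m // Function.Surjective φ}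
  id n := ⟨id, Function.surjective_id⟩
  comp f g := ⟨f.1 ∘ g.1, f.2.comp g.2⟩
  tensor f g := ⟨finSumMap f.1 g.1, finSumMap_surjective f.2 g.2⟩
  symm m n := ⟨finAddFlip, finAddFlip.surjective⟩
  id_comp f := rfl
  comp_id f := rfl
  comp_assoc f g h := rfl
  tensor_id m n := Subtype.ext <| funext fun j => by
    induction j using Fin.addCases <;> simp [finSumMap_castAdd, finSumMap_natAdd]
  tensor_comp f g f' g' := Subtype.ext <| funext fun j => by
    induction j using Fin.addCases <;> simp [finSumMap_castAdd, finSumMap_natAdd]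
  tensor_assoc {m n m' n' m'' n''} f g h := Subtype.ext <| funext fun j => by
    rw [castHom_surj]
    obtain ⟨j, rfl⟩ : ∃ i, j = Fin.cast (Nat.add_assoc n n' n'') i :=
      ⟨Fin.cast (by omega) j, rfl⟩
    rw [Fin.cast_cast, Fin.cast_eq_self]
    induction j using Fin.addCases with
    | left j =>
      induction j using Fin.addCases with
      | left j =>
        rw [Wiring.cast_castAdd_castAdd]
        simp only [finSumMap_castAdd, Wiring.cast_castAdd_castAdd]
      | right j =>
        rw [Wiring.cast_castAdd_natAdd]
        simp only [finSumMap_castAdd, finSumMap_natAdd, Wiring.cast_castAdd_natAdd]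
    | right j =>
      rw [Wiring.cast_natAdd]
      simp only [finSumMap_natAdd, Wiring.cast_natAdd]
  zero_tensor {m n} f := Subtype.ext <| funext fun j => by
    rw [castHom_surj]
    obtain ⟨j, rfl⟩ : ∃ i, j = Fin.cast (Nat.zero_add n) i :=
      ⟨Fin.cast (by omega) j, rfl⟩
    rw [Fin.cast_cast, Fin.cast_eq_self]
    induction j using Fin.addCases with
    | left j => exact j.elim0
    | right j =>
      dsimp only
      rw [finSumMap_natAdd, Wiring.cast_natAdd_zero, Wiring.cast_natAdd_zero]
  tensor_zero f := Subtype.ext <| funext fun j => finSumMap_castAdd f.1 id j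
  symm_natural f g := Subtype.ext <| funext fun j => by
    induction j using Fin.addCases <;> simp [finSumMap_castAdd, finSumMap_natAdd]
  symm_symm m n := Subtype.ext <| funext fun j => by
    induction j using Fin.addCases <;> simp
  symm_hexagon m n p := Subtype.ext <| funext fun j => by
    rw [castHom_surj]
    obtain ⟨j, rfl⟩ : ∃ i, j = Fin.cast (Nat.add_assoc n p m) i :=
      ⟨Fin.cast (by omega) j, rfl⟩
    rw [Fin.cast_cast, Fin.cast_eq_self]
    refine (surj_hexagon m n p j).trans (congrArg (fun z => z) ?_)
    exact (castHom_surj rfl (Nat.add_assoc n m p) ⟨finSumMap finAddFlip id,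
      finSumMap_surjective finAddFlip.surjective Function.surjective_id⟩ _).symm

/-- The unique function from a two-element set to a one-element set, as a morphism `1 → 2`. -/
def SurjOp.delta : SurjOp.Hom 1 2 :=
  (⟨fun _ => 0, fun i => ⟨0, (Subsingleton.elim i 0).symm⟩⟩ :
    {φ : Fin 2 → Fin 1 // Function.Surjective φ})

end AncestryPROP

open AncestryPROP

universe w

namespace AncestryPROP
open Sum

/-! Every vertex of a diagram has a single incoming half-edge, so from a vertex or an output one can
walk backwards along wires in only one way, and finiteness with acyclicity makes the walk stop at an
input. A diagram `m → n` thus determines a function `φ` from outputs to inputs, its root function.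
It is surjective, because a forward walk from an input, always taking the left half-edge, must stop
at an output. Roots are constant on connected components and every node is connected to its root, so
the ancestry relation identifies exactly the boundary elements with equal root
(`Diagram.IsRoot.ancestry_eq`). Root functions compose and juxtapose like functions, which makes
ancestry a functor, and conditions (a) and (b) say precisely that a corelation comes from a
surjection (`SurjOp.exists_corel_eq`).

The substance is the presentation of surjections by `δ`: the functor `Cocom.toSurjOp` is bijective
on morphisms. Reading outputs from the last one downwards, a surjection is built from two kinds of
steps: a copy of an input strand is split off to the end if that input has further outputs, and the
strand itself is moved to the end otherwise. This yields one normal form for each surjection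
(`NormalForm.unique`, `NormalForm.exists_of_surjective`), hence fullness.

For faithfulness, every morphism must equal the normal form of its image. Since all morphisms are
generated by `swapLast`, `atLast` and adding strands on the right (`StrandGen.eval`), it suffices
that composing a normal form with one of these is again a normal form. The critical case is a
crossing of the last two outputs (`NormalForm.comp_swapLast`); it rests on the exchange relations
`IsCocom.split_split`, `IsCocom.split_move_self`, `move_split` and `move_move`.

Finally, a term representing a morphism of `Cocom` can be evaluated in `Syn` as well, so the image
of the ancestry functor contains every corelation that comes from a surjection. -/

namespace PROP

/-! ### Strand calculus in a PROP: crossings and comultiplications on the last strands. -/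

variable (P : PROP.{u})

/-- Adding one strand on the right. -/
def whisker {m n : ℕ} (f : P.Hom m n) : P.Hom (m + 1) (n + 1) := P.tensor f (P.id 1)

/-- The transposition of the last two strands. -/
def swapLast (n : ℕ) : P.Hom (n + 1 + 1) (n + 1 + 1) :=
  (P.tensor (P.id n) (P.symm 1 1) : P.Hom (n + (1 + 1)) (n + (1 + 1)))

/-- A morphism `1 → 2` applied to the last strand. -/
def atLast (δ : P.Hom 1 2) (n : ℕ) : P.Hom (n + 1) (n + 1 + 1) :=
  (P.tensor (P.id n) δ : P.Hom (n + 1) (n + 2))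

variable {P}

theorem comp_castHom {a b c a' b' c' : ℕ} (ha : a = a') (hb : b = b') (hc : c = c')
    (f : P.Hom a b) (g : P.Hom b c) :
    castHom ha hc (P.comp f g) = P.comp (castHom ha hb f) (castHom hb hc g) := by
  subst ha hb hc; rfl

theorem tensor_eq_left_right {m n m' n' : ℕ} (f : P.Hom m n) (g : P.Hom m' n') :
    P.tensor f g = P.comp (P.tensor f (P.id m')) (P.tensor (P.id n) g) := by
  rw [← P.tensor_comp, P.comp_id, P.id_comp]

theorem tensor_eq_right_left {m n m' n' : ℕ} (f : P.Hom m n) (g : P.Hom m' n') :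
    P.tensor f g = P.comp (P.tensor (P.id m) g) (P.tensor f (P.id n')) := by
  rw [← P.tensor_comp, P.comp_id, P.id_comp]

theorem whisker_id (n : ℕ) : P.whisker (P.id n) = P.id (n + 1) := P.tensor_id n 1

theorem whisker_comp {m n p : ℕ} (f : P.Hom m n) (g : P.Hom n p) :
    P.whisker (P.comp f g) = P.comp (P.whisker f) (P.whisker g) := by
  unfold whisker
  rw [← P.tensor_comp, P.comp_id]

/-- Addition on `ℕ` recurses on its second argument, so `m + (m' + 1)` and `m + m' + 1` agree
definitionally and the transport in `tensor_assoc` disappears. This is why all constructions here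
grow on the right and act on the last strands. -/
theorem whisker_tensor {m n m' n' : ℕ} (f : P.Hom m n) (g : P.Hom m' n') :
    P.whisker (P.tensor f g) = P.tensor f (P.whisker g) := P.tensor_assoc f g (P.id 1)

theorem whisker_whisker {m n : ℕ} (f : P.Hom m n) :
    P.whisker (P.whisker f) = P.tensor f (P.id 2) := by
  rw [← P.tensor_id 1 1]
  exact whisker_tensor f (P.id 1)

theorem tensor_id_succ {m n k : ℕ} (f : P.Hom m n) :
    P.tensor f (P.id (k + 1)) = P.whisker (P.tensor f (P.id k)) := by
  rw [whisker_tensor, whisker_id]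

theorem id_tensor_swapLast (m n : ℕ) :
    P.tensor (P.id m) (P.swapLast n) = P.swapLast (m + n) := by
  have h := P.tensor_assoc (P.id m) (P.id n) (P.symm 1 1)
  rw [P.tensor_id] at h
  exact h.symm

theorem id_tensor_atLast (δ : P.Hom 1 2) (m n : ℕ) :
    P.tensor (P.id m) (P.atLast δ n) = P.atLast δ (m + n) := by
  have h := P.tensor_assoc (P.id m) (P.id n) δ
  rw [P.tensor_id] at h
  exact h.symm

/-- The transposition of the first two of three strands. -/
def swapLeft (P : PROP.{u}) : P.Hom 3 3 :=
  (P.tensor (P.symm 1 1) (P.id 1) : P.Hom (1 + 1 + 1) (1 + 1 + 1))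

/-- The transposition of the last two of three strands. -/
def swapRight (P : PROP.{u}) : P.Hom 3 3 :=
  (P.tensor (P.id 1) (P.symm 1 1) : P.Hom (1 + (1 + 1)) (1 + (1 + 1)))

theorem whisker_swapLast (n : ℕ) :
    P.whisker (P.swapLast n) = P.tensor (P.id n) P.swapLeft :=
  whisker_tensor (P.id n) (P.symm 1 1)

theorem swapLast_succ (n : ℕ) : P.swapLast (n + 1) = P.tensor (P.id n) P.swapRight :=
  (id_tensor_swapLast n 1).symm

theorem whisker_atLast (δ : P.Hom 1 2) (n : ℕ) :
    P.whisker (P.atLast δ n) = P.tensor (P.id n) (P.tensor δ (P.id 1)) :=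
  whisker_tensor (P.id n) δ

theorem atLast_succ (δ : P.Hom 1 2) (n : ℕ) :
    P.atLast δ (n + 1) = P.tensor (P.id n) (P.tensor (P.id 1) δ) :=
  (id_tensor_atLast δ n 1).symm

theorem id_tensor_comp {k m n p : ℕ} (f : P.Hom m n) (g : P.Hom n p) :
    P.tensor (P.id k) (P.comp f g) = P.comp (P.tensor (P.id k) f) (P.tensor (P.id k) g) := by
  rw [← P.tensor_comp, P.comp_id]

theorem swapLast_swapLast (n : ℕ) :
    P.comp (P.swapLast n) (P.swapLast n) = P.id (n + 1 + 1) :=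
  (id_tensor_comp (P.symm 1 1) (P.symm 1 1)).symm.trans
    ((congrArg (P.tensor (P.id n)) (P.symm_symm 1 1)).trans (P.tensor_id n (1 + 1)))

theorem swapLast_natural {m n : ℕ} (f : P.Hom m n) :
    P.comp (P.whisker (P.whisker f)) (P.swapLast n) =
      P.comp (P.swapLast m) (P.whisker (P.whisker f)) := by
  rw [whisker_whisker]
  exact (tensor_eq_left_right f (P.symm 1 1)).symm.trans (tensor_eq_right_left f (P.symm 1 1))

theorem atLast_natural (δ : P.Hom 1 2) {m n : ℕ} (f : P.Hom m n) :
    P.comp (P.whisker f) (P.atLast δ n) = P.comp (P.atLast δ m) (P.whisker (P.whisker f)) := by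
  rw [whisker_whisker]
  exact (tensor_eq_left_right f δ).symm.trans (tensor_eq_right_left f δ)

theorem symm_one_two : (P.symm 1 2 : P.Hom 3 3) = P.comp P.swapLeft P.swapRight :=
  P.symm_hexagon 1 1 1

theorem swapRight_swapRight : P.comp P.swapRight P.swapRight = P.id 3 := swapLast_swapLast 1

theorem swapLeft_swapLeft : P.comp P.swapLeft P.swapLeft = P.id 3 :=
  (whisker_comp (P.symm 1 1) (P.symm 1 1)).symm.trans
    ((congrArg P.whisker (P.symm_symm 1 1)).trans (whisker_id 2))

/-- The product on the right inverts `symm 1 2`, its factors being involutions, and so does `symm 2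
1`. -/
theorem symm_two_one : (P.symm 2 1 : P.Hom 3 3) = P.comp P.swapRight P.swapLeft := by
  have h₃ : P.comp (P.symm 1 2 : P.Hom 3 3) (P.comp P.swapRight P.swapLeft) = P.id 3 := by
    rw [symm_one_two, P.comp_assoc, ← P.comp_assoc P.swapRight, swapRight_swapRight, P.id_comp,
      swapLeft_swapLeft]
  have h₄ : P.comp (P.symm 2 1 : P.Hom 3 3) (P.symm 1 2 : P.Hom 3 3) = P.id 3 := P.symm_symm 2 1
  rw [← P.comp_id (m := 3) (n := 3) (P.symm 2 1 : P.Hom 3 3), ← h₃, ← P.comp_assoc, h₄, P.id_comp]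

/-- The braid relation is naturality of `symm 1 2` with respect to the crossing of two strands. -/
theorem swapRight_braid : P.comp P.swapRight (P.comp P.swapLeft P.swapRight) =
    P.comp P.swapLeft (P.comp P.swapRight P.swapLeft) := by
  have h : P.comp P.swapRight (P.symm 1 2 : P.Hom 3 3) =
    P.comp (P.symm 1 2 : P.Hom 3 3) P.swapLeft := P.symm_natural (P.id 1) (P.symm 1 1)
  rwa [symm_one_two, P.comp_assoc] at h

theorem swapLast_braid (n : ℕ) :
    P.comp (P.swapLast (n + 1)) (P.comp (P.whisker (P.swapLast n)) (P.swapLast (n + 1))) =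
      P.comp (P.whisker (P.swapLast n))
        (P.comp (P.swapLast (n + 1)) (P.whisker (P.swapLast n))) := by
  have k := congrArg (P.tensor (P.id n)) (swapRight_braid (P := P))
  simp only [id_tensor_comp, ← swapLast_succ, ← whisker_swapLast] at k
  exact k

/-- Naturality of the symmetry at `δ`, with `symm 2 1` resolved into two crossings. -/
theorem swapLast_atLast (δ : P.Hom 1 2) (n : ℕ) :
    P.comp (P.swapLast n) (P.atLast δ (n + 1)) =
      P.comp (P.whisker (P.atLast δ n))
        (P.comp (P.swapLast (n + 1)) (P.whisker (P.swapLast n))) := by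
  have h : P.comp (P.tensor δ (P.id 1) : P.Hom 2 3) (P.symm 2 1 : P.Hom 3 3) =
    P.comp (P.symm 1 1 : P.Hom 2 2) (P.tensor (P.id 1) δ : P.Hom 2 3) :=
      P.symm_natural δ (P.id 1)
  rw [symm_two_one] at h
  have k := congrArg (P.tensor (P.id n)) h
  rw [id_tensor_comp, id_tensor_comp, id_tensor_comp] at k
  rw [swapLast_succ, whisker_swapLast, whisker_atLast, atLast_succ]
  exact k.symm

/-- The mirror image of `swapLast_atLast`, obtained from it by composing with crossings on both
sides and cancelling them as involutions. -/
theorem swapLast_whisker_atLast (δ : P.Hom 1 2) (n : ℕ) :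
    P.comp (P.swapLast n) (P.whisker (P.atLast δ n)) =
      P.comp (P.atLast δ (n + 1))
        (P.comp (P.whisker (P.swapLast n)) (P.swapLast (n + 1))) := by
  have h₁ : P.comp (P.whisker (P.swapLast n)) (P.whisker (P.swapLast n)) = P.id _ := by
    rw [← whisker_comp, swapLast_swapLast, whisker_id]
  have h := congrArg (fun x => P.comp (P.swapLast n)
    (P.comp x (P.comp (P.whisker (P.swapLast n)) (P.swapLast (n + 1))))) (swapLast_atLast δ n)
  simp only [P.comp_assoc] at h
  rw [← P.comp_assoc (P.swapLast n), swapLast_swapLast, P.id_comp,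
    ← P.comp_assoc (P.whisker (P.swapLast n)), h₁, P.id_comp, swapLast_swapLast, P.comp_id] at h
  exact h.symm

/-- Cocommutative coassociative comultiplications on the object `1`. -/
structure IsCocom (δ : P.Hom 1 2) : Prop where
  coassoc : P.comp δ (P.tensor δ (P.id 1) : P.Hom 2 3) = P.comp δ (P.tensor (P.id 1) δ : P.Hom 2 3)
  cocomm : P.comp δ (P.symm 1 1 : P.Hom 2 2) = δ

theorem IsCocom.atLast_coassoc {δ : P.Hom 1 2} (h : IsCocom δ) (n : ℕ) :
    P.comp (P.atLast δ n) (P.atLast δ (n + 1)) =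
      P.comp (P.atLast δ n) (P.whisker (P.atLast δ n)) := by
  have k := congrArg (P.tensor (P.id n)) h.coassoc
  rw [id_tensor_comp, id_tensor_comp] at k
  rw [whisker_atLast, atLast_succ]
  exact k.symm

theorem IsCocom.atLast_cocomm {δ : P.Hom 1 2} (h : IsCocom δ) (n : ℕ) :
    P.comp (P.atLast δ n) (P.swapLast n) = P.atLast δ n := by
  have k := congrArg (P.tensor (P.id n)) h.cocomm
  rw [id_tensor_comp] at k
  exact k

/-! ### Moving a strand, or a copy of it, to the end; exchange relations. -/

variable (P) in
/-- The permutation moving the strand `i` to the end. -/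
def moveLast : ∀ k : ℕ, Fin (k + 1) → P.Hom (k + 1) (k + 1)
  | 0, _ => P.id 1
  | k + 1, i => Fin.lastCases (motive := fun _ => P.Hom (k + 2) (k + 2)) (P.id (k + 2))
      (fun i => P.comp (P.whisker (moveLast k i)) (P.swapLast k)) i

/-- Duplicating the strand `i` and moving one of the copies to the end. -/
def splitLast (δ : P.Hom 1 2) : ∀ k : ℕ, Fin k → P.Hom k (k + 1)
  | 0, i => i.elim0
  | k + 1, i => Fin.lastCases (motive := fun _ => P.Hom (k + 1) (k + 2)) (P.atLast δ k)
      (fun i => P.comp (P.whisker (splitLast δ k i)) (P.swapLast k)) i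

theorem moveLast_last (k : ℕ) : P.moveLast k (Fin.last k) = P.id (k + 1) := by
  cases k with
  | zero => rfl
  | succ k => exact Fin.lastCases_last

theorem moveLast_castSucc (k : ℕ) (i : Fin (k + 1)) : P.moveLast (k + 1) i.castSucc =
    P.comp (P.whisker (P.moveLast k i)) (P.swapLast k) := Fin.lastCases_castSucc _

theorem splitLast_last (δ : P.Hom 1 2) (k : ℕ) :
    splitLast δ (k + 1) (Fin.last k) = P.atLast δ k := Fin.lastCases_last

theorem splitLast_castSucc (δ : P.Hom 1 2) (k : ℕ) (i : Fin k) : splitLast δ (k + 1) i.castSucc =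
    P.comp (P.whisker (splitLast δ k i)) (P.swapLast k) := Fin.lastCases_castSucc _

/-- An exchange relation is preserved when a strand is inserted before the last ones. -/
theorem exchange_whisker {a b b' c : ℕ} {f : P.Hom a (b + 1)} {g : P.Hom b (c + 1)}
    {f' : P.Hom a (b' + 1)} {g' : P.Hom b' (c + 1)}
    (h : P.comp f (P.comp (P.whisker g) (P.swapLast c)) = P.comp f' (P.whisker g')) :
    P.comp (P.comp (P.whisker f) (P.swapLast b))
        (P.comp (P.whisker (P.comp (P.whisker g) (P.swapLast c))) (P.swapLast (c + 1))) =
      P.comp (P.comp (P.whisker f') (P.swapLast b'))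
        (P.whisker (P.comp (P.whisker g') (P.swapLast c))) := by
  have h' := congrArg (fun x => P.comp (P.whisker x)
    (P.comp (P.swapLast (c + 1)) (P.whisker (P.swapLast c)))) h
  simp only [whisker_comp, P.comp_assoc] at h' ⊢
  -- The crossing slides past `g`, the braid relation reorders the three crossings so that the
  -- whiskered hypothesis applies, and the remaining crossing slides back past `g'`.
  rw [← P.comp_assoc (P.swapLast b), ← swapLast_natural, P.comp_assoc, swapLast_braid, h',
    ← P.comp_assoc (P.whisker (P.whisker g')), swapLast_natural, P.comp_assoc]

theorem comp_swapLast_comm {a c : ℕ} {x y : P.Hom a (c + 1 + 1)}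
    (h : P.comp x (P.swapLast c) = y) : P.comp y (P.swapLast c) = x := by
  rw [← h, P.comp_assoc, swapLast_swapLast, P.comp_id]

/-- For `i = j` the two new copies must be interchangeable: coassociativity turns the second
duplication into one on the last strand, where cocommutativity absorbs the crossing. Different
strands need only naturality and the braid relation. -/
theorem IsCocom.split_split {δ : P.Hom 1 2} (h : IsCocom δ) : ∀ (k : ℕ) (i j : Fin k),
    P.comp (splitLast δ k i) (P.comp (P.whisker (splitLast δ k j)) (P.swapLast k)) =
      P.comp (splitLast δ k j) (P.whisker (splitLast δ k i)) := by
  intro k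
  induction k with
  | zero => exact fun i => i.elim0
  | succ k ih =>
    -- Exactly one of the two strands is the last. The opposite order of the strands follows from
    -- this one because the crossing is an involution.
    have key : ∀ j : Fin k, P.comp (splitLast δ (k + 1) (Fin.last k))
        (P.comp (P.whisker (splitLast δ (k + 1) j.castSucc)) (P.swapLast (k + 1))) =
          P.comp (splitLast δ (k + 1) j.castSucc)
            (P.whisker (splitLast δ (k + 1) (Fin.last k))) := by
      intro j
      rw [splitLast_last, splitLast_castSucc, whisker_comp, P.comp_assoc, P.comp_assoc,
        swapLast_whisker_atLast, ← P.comp_assoc (P.atLast δ k), ← atLast_natural, P.comp_assoc]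
    intro i j
    induction i using Fin.lastCases with
    | last =>
      induction j using Fin.lastCases with
      | last =>
        rw [splitLast_last, ← P.comp_assoc, ← h.atLast_coassoc, P.comp_assoc, h.atLast_cocomm]
      | cast j => exact key j
    | cast i =>
      induction j using Fin.lastCases with
      | last =>
        rw [← P.comp_assoc]
        exact comp_swapLast_comm ((P.comp_assoc _ _ _).trans (key i))
      | cast j =>
        simp only [splitLast_castSucc]
        exact exchange_whisker (ih i j)

/-- The move puts the original next to its copy at the end, and a crossing of two copies is absorbed
by cocommutativity. -/
theorem IsCocom.split_move_self {δ : P.Hom 1 2} (h : IsCocom δ) : ∀ (k : ℕ) (i : Fin (k + 1)),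
    P.comp (splitLast δ (k + 1) i) (P.comp (P.whisker (P.moveLast k i)) (P.swapLast k)) =
      P.comp (splitLast δ (k + 1) i) (P.whisker (P.moveLast k i)) := by
  have last : ∀ k, P.comp (splitLast δ (k + 1) (Fin.last k))
      (P.comp (P.whisker (P.moveLast k (Fin.last k))) (P.swapLast k)) =
        P.comp (splitLast δ (k + 1) (Fin.last k)) (P.whisker (P.moveLast k (Fin.last k))) := by
    intro k
    rw [splitLast_last, moveLast_last, whisker_id, P.id_comp, P.comp_id, h.atLast_cocomm]
  intro k
  induction k with
  | zero =>
    intro i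
    obtain rfl : i = Fin.last 0 := Fin.fin_one_eq_zero i
    exact last 0
  | succ k ih =>
    intro i
    induction i using Fin.lastCases with
    | last => exact last (k + 1)
    | cast i =>
      rw [splitLast_castSucc, moveLast_castSucc]
      exact exchange_whisker (ih i)

/-- Once strand `j` has been set aside, number `i` among the others denotes the original strand
`j.succAbove i`. The two operations concern different strands, so naturality suffices. -/
theorem move_split (δ : P.Hom 1 2) : ∀ (k : ℕ) (j : Fin (k + 1)) (i : Fin k),
    P.comp (P.moveLast k j) (P.comp (P.whisker (splitLast δ k i)) (P.swapLast k)) =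
      P.comp (splitLast δ (k + 1) (j.succAbove i)) (P.whisker (P.moveLast k j)) := by
  intro k
  induction k with
  | zero => exact fun _ i => i.elim0
  | succ k ih =>
    intro j i
    induction j using Fin.lastCases with
    | last =>
      rw [Fin.succAbove_last, moveLast_last, splitLast_castSucc, whisker_id, P.id_comp, P.comp_id]
    | cast j =>
      induction i using Fin.lastCases with
      | last =>
        rw [Fin.succAbove_ne_last_last (Fin.castSucc_ne_last j), splitLast_last, splitLast_last,
          moveLast_castSucc, whisker_comp, P.comp_assoc, ← P.comp_assoc (P.swapLast k),
          swapLast_whisker_atLast, P.comp_assoc, P.comp_assoc, swapLast_swapLast, P.comp_id,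
          ← P.comp_assoc, atLast_natural, P.comp_assoc]
      | cast i =>
        rw [Fin.castSucc_succAbove_castSucc, splitLast_castSucc, moveLast_castSucc,
          splitLast_castSucc]
        exact exchange_whisker (ih j i)

/-- The renumbering on the right: among the strands other than `i.succAbove j`, the original strand
`i` carries the number `j.predAbove i`. -/
theorem move_move (k : ℕ) (i : Fin (k + 2)) (j : Fin (k + 1)) :
    P.comp (P.moveLast (k + 1) i) (P.comp (P.whisker (P.moveLast k j)) (P.swapLast k)) =
      P.comp (P.moveLast (k + 1) (i.succAbove j)) (P.whisker (P.moveLast k (j.predAbove i))) := by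
  have last : ∀ (k : ℕ) (i : Fin (k + 1)),
      P.comp (P.moveLast (k + 1) i.castSucc)
        (P.comp (P.whisker (P.moveLast k (Fin.last k))) (P.swapLast k)) =
      P.comp (P.moveLast (k + 1) (i.castSucc.succAbove (Fin.last k)))
        (P.whisker (P.moveLast k ((Fin.last k).predAbove i.castSucc))) := by
    intro k i
    rw [Fin.succAbove_ne_last_last (Fin.castSucc_ne_last i), Fin.predAbove_last_castSucc,
      moveLast_last, moveLast_last, moveLast_castSucc, whisker_id, P.id_comp, P.id_comp,
      P.comp_assoc, swapLast_swapLast, P.comp_id]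
  induction k with
  | zero =>
    obtain rfl : j = Fin.last 0 := Fin.fin_one_eq_zero j
    induction i using Fin.lastCases with
    | last =>
      rw [Fin.succAbove_last, moveLast_last, moveLast_castSucc, Fin.predAbove_right_last,
        moveLast_last, whisker_id, P.id_comp, P.comp_id]
    | cast i => exact last 0 i
  | succ k ih =>
    induction i using Fin.lastCases with
    | last =>
      rw [Fin.succAbove_last, moveLast_last, moveLast_castSucc, Fin.predAbove_right_last,
        moveLast_last, whisker_id, P.id_comp, P.comp_id]
    | cast i =>
      induction j using Fin.lastCases with
      | last => exact last (k + 1) i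
      | cast j =>
        rw [Fin.castSucc_succAbove_castSucc, Fin.castSucc_predAbove_castSucc, moveLast_castSucc,
          moveLast_castSucc, moveLast_castSucc, moveLast_castSucc]
        exact exchange_whisker (ih i j)

/-- The analogue of `exchange_whisker` for `δ` on the last strand, serving as induction step for
`IsCocom.split_atLast` and `move_atLast`: `δ` slides through the crossing, the hypothesis applies,
and the crossing slides back past `f'`. -/
theorem split_whisker (δ : P.Hom 1 2) {a b c : ℕ} {f : P.Hom a (b + 1)} {g : P.Hom a (c + 1)}
    {f' : P.Hom c (b + 1)} (h : P.comp f (P.atLast δ b) = P.comp g (P.whisker f')) :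
    P.comp (P.comp (P.whisker f) (P.swapLast b)) (P.atLast δ (b + 1)) =
      P.comp (P.comp (P.whisker g) (P.swapLast c))
        (P.whisker (P.comp (P.whisker f') (P.swapLast b))) := by
  have h' := congrArg (fun x => P.comp (P.whisker x)
    (P.comp (P.swapLast (b + 1)) (P.whisker (P.swapLast b)))) h
  simp only [whisker_comp, P.comp_assoc] at h' ⊢
  rw [swapLast_atLast, h', ← P.comp_assoc (P.whisker (P.whisker f')), swapLast_natural,
    P.comp_assoc]

/-- By coassociativity, duplicating the copy at the end amounts to duplicating the original a second
time. -/
theorem IsCocom.split_atLast {δ : P.Hom 1 2} (h : IsCocom δ) (k : ℕ) (i : Fin (k + 1)) :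
    P.comp (splitLast δ (k + 1) i) (P.atLast δ (k + 1)) =
      P.comp (splitLast δ (k + 1) i) (P.whisker (splitLast δ (k + 1) i)) := by
  induction k with
  | zero =>
    obtain rfl : i = Fin.last 0 := Fin.fin_one_eq_zero i
    rw [splitLast_last, h.atLast_coassoc]
  | succ k ih =>
    induction i using Fin.lastCases with
    | last => rw [splitLast_last, h.atLast_coassoc]
    | cast i =>
      rw [splitLast_castSucc]
      exact split_whisker δ (ih i)

/-- A strand may be duplicated before it travels to the end instead of after: one copy goes ahead,
and the original follows it. -/
theorem move_atLast (δ : P.Hom 1 2) (k : ℕ) (i : Fin (k + 1)) :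
    P.comp (P.moveLast k i) (P.atLast δ k) =
      P.comp (splitLast δ (k + 1) i) (P.whisker (P.moveLast k i)) := by
  induction k with
  | zero =>
    obtain rfl : i = Fin.last 0 := Fin.fin_one_eq_zero i
    rw [splitLast_last, moveLast_last, whisker_id, P.id_comp, P.comp_id]
  | succ k ih =>
    induction i using Fin.lastCases with
    | last => rw [splitLast_last, moveLast_last, whisker_id, P.id_comp, P.comp_id]
    | cast i =>
      rw [splitLast_castSucc, moveLast_castSucc]
      exact split_whisker δ (ih i)

/-! ### Generation of all composites by moves on the last strands. -/

/-- The morphisms obtained from identities, transpositions of the last two strands and `δ` on the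
last strand by composition and by adding strands on the right. -/
inductive StrandGen (δ : P.Hom 1 2) : ∀ {m n : ℕ}, P.Hom m n → Prop
  | id (n : ℕ) : StrandGen δ (P.id n)
  | comp {m n p : ℕ} {f : P.Hom m n} {g : P.Hom n p} :
    StrandGen δ f → StrandGen δ g → StrandGen δ (P.comp f g)
  | whisker {m n : ℕ} {f : P.Hom m n} : StrandGen δ f → StrandGen δ (P.whisker f)
  | swapLast (n : ℕ) : StrandGen δ (P.swapLast n)
  | atLast (n : ℕ) : StrandGen δ (P.atLast δ n)

theorem castHom_id {n n' : ℕ} (h : n = n') : castHom h h (P.id n) = P.id n' := by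
  subst h; rfl

theorem castHom_castHom {H : ℕ → ℕ → Type u} {m m' m'' n n' n'' : ℕ} (h : m = m') (h' : m' = m'')
    (k : n = n') (k' : n' = n'') (f : H m n) :
    castHom h' k' (castHom h k f) = castHom (h.trans h') (k.trans k') f := by
  subst h h' k k'; rfl

namespace StrandGen

variable {δ : P.Hom 1 2}

theorem castHom_iff {m m' n n' : ℕ} (hm : m = m') (hn : n = n') {f : P.Hom m n} :
    StrandGen δ (castHom hm hn f) ↔ StrandGen δ f := by
  subst hm hn; rfl

theorem tensor_id {m n : ℕ} {f : P.Hom m n} (h : StrandGen δ f) (k : ℕ) :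
    StrandGen δ (P.tensor f (P.id k)) := by
  induction k with
  | zero => rw [← P.tensor_zero f] at h; exact h
  | succ k ih => rw [tensor_id_succ]; exact ih.whisker

/-- Strands added on the left are absorbed into the index of `swapLast` and `atLast`; this is what
allows `StrandGen` to be closed only under adding strands on the right. -/
theorem id_tensor (k : ℕ) {m n : ℕ} {f : P.Hom m n} (h : StrandGen δ f) :
    StrandGen δ (P.tensor (P.id k) f) := by
  induction h with
  | id n => rw [P.tensor_id]; exact .id _
  | comp _ _ ih ih' => rw [id_tensor_comp]; exact ih.comp ih'
  | whisker _ ih => rw [← whisker_tensor]; exact ih.whisker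
  | swapLast n => rw [id_tensor_swapLast]; exact .swapLast _
  | atLast n => rw [id_tensor_atLast]; exact .atLast _

theorem tensor {m n m' n' : ℕ} {f : P.Hom m n} {g : P.Hom m' n'} (hf : StrandGen δ f)
    (hg : StrandGen δ g) : StrandGen δ (P.tensor f g) := by
  rw [tensor_eq_left_right]
  exact (hf.tensor_id _).comp (hg.id_tensor _)

theorem delta : StrandGen δ δ := by
  have h := StrandGen.atLast (δ := δ) 0
  rw [← castHom_iff (Nat.zero_add 1) (Nat.zero_add 2)] at h
  exact (P.zero_tensor δ : castHom _ _ (P.atLast δ 0) = δ).subst (motive := StrandGen δ) h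

theorem symm_one_one : StrandGen δ (P.symm 1 1) := by
  have h := StrandGen.swapLast (δ := δ) 0
  rw [← castHom_iff (Nat.zero_add 2) (Nat.zero_add 2)] at h
  exact (P.zero_tensor (P.symm 1 1)) ▸ h

end StrandGen

/-- The hexagon with two empty factors shows that the symmetry with the unit object is idempotent.
It is also invertible, hence an identity. -/
theorem castHom_symm_zero (m : ℕ) : castHom (Nat.add_zero m) (Nat.zero_add m) (P.symm m 0) =
    P.id m := by
  have h := P.symm_hexagon m 0 0
  have h₀ := P.zero_tensor (P.symm m 0)
  have h₁ : castHom rfl (Nat.add_assoc 0 m 0) (P.tensor (P.symm m 0) (P.id 0)) = P.symm m 0 :=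
    P.tensor_zero (P.symm m 0)
  rw [h₁] at h
  set Y : P.Hom m m := castHom (Nat.add_zero m) (Nat.zero_add m) (P.symm m 0) with hY
  have e : P.comp Y Y = Y := by
    have k := congrArg (castHom (H := P.Hom) (Nat.add_zero m)
      ((Nat.zero_add _).trans (Nat.zero_add m))) h
    rw [castHom_castHom, comp_castHom (Nat.add_zero m) (Nat.zero_add m)] at k
    refine Eq.trans ?_ k.symm
    congr 1
    rw [hY, ← castHom_castHom (Nat.zero_add _) (Nat.add_zero m) (Nat.zero_add _) (Nat.zero_add m),
      h₀]
  have i : P.comp Y (castHom (Nat.zero_add m) (Nat.add_zero m) (P.symm 0 m)) = P.id m := by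
    rw [hY, ← comp_castHom, P.symm_symm]
    rfl
  calc Y = P.comp Y (P.comp Y (castHom (Nat.zero_add m) (Nat.add_zero m) (P.symm 0 m))) := by
        rw [i, P.comp_id]
    _ = P.id m := by rw [← P.comp_assoc, e, i]

namespace StrandGen

variable {δ : P.Hom 1 2}

theorem symm_zero (m : ℕ) : StrandGen δ (P.symm m 0) := by
  rw [← castHom_iff (Nat.add_zero m) (Nat.zero_add m), castHom_symm_zero]
  exact .id m

theorem symm_zero_left (m : ℕ) : StrandGen δ (P.symm 0 m) := by
  have h : P.comp (castHom (Nat.add_zero m) (Nat.zero_add m) (P.symm m 0))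
      (castHom (Nat.zero_add m) (Nat.add_zero m) (P.symm 0 m)) = P.id m := by
    rw [← comp_castHom, P.symm_symm]
    rfl
  rw [castHom_symm_zero, P.id_comp] at h
  rw [← castHom_iff (Nat.zero_add m) (Nat.add_zero m), h]
  exact .id m

end StrandGen

theorem symm_succ_right (m n : ℕ) :
    castHom rfl (Nat.add_assoc n 1 m) (P.symm m (n + 1)) =
      P.comp (castHom rfl (Nat.add_assoc n m 1) (P.tensor (P.symm m n) (P.id 1)))
        (P.tensor (P.id n) (P.symm m 1)) := P.symm_hexagon m n 1

/-- Both sides are inverse to `symm m (n + 1)`, which `symm_succ_right` has already decomposed. -/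
theorem symm_succ_left (m n : ℕ) :
    castHom (Nat.add_assoc n 1 m) rfl (P.symm (n + 1) m) =
      P.comp (P.tensor (P.id n) (P.symm 1 m))
        (castHom (Nat.add_assoc n m 1) rfl (P.tensor (P.symm n m) (P.id 1))) := by
  set A := castHom rfl (Nat.add_assoc n 1 m) (P.symm m (n + 1)) with hA
  set B := castHom (Nat.add_assoc n 1 m) rfl (P.symm (n + 1) m) with hB
  set C := P.comp (P.tensor (P.id n) (P.symm 1 m))
        (castHom (Nat.add_assoc n m 1) rfl (P.tensor (P.symm n m) (P.id 1))) with hC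
  have h₁ : P.comp B A = P.id _ := by
    rw [hA, hB, ← comp_castHom, P.symm_symm, castHom_id]
  have h₂ : P.comp A C = P.id _ := by
    rw [hA, symm_succ_right, hC, P.comp_assoc, ← P.comp_assoc (P.tensor (P.id n) (P.symm m 1)),
      ← id_tensor_comp, P.symm_symm, P.tensor_id, P.id_comp, ← comp_castHom, ← P.tensor_comp,
      P.symm_symm, P.comp_id, P.tensor_id, castHom_id]
  calc B = P.comp B (P.comp A C) := by rw [h₂, P.comp_id]
    _ = C := by rw [← P.comp_assoc, h₁, P.id_comp]

namespace StrandGen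

variable {δ : P.Hom 1 2}

theorem symm_one (n : ℕ) : StrandGen δ (P.symm 1 n) := by
  induction n with
  | zero => exact symm_zero 1
  | succ n ih =>
    rw [← castHom_iff rfl (Nat.add_assoc n 1 1), symm_succ_right]
    exact ((castHom_iff _ _).2 ih.whisker).comp (symm_one_one.id_tensor n)

theorem symm (m n : ℕ) : StrandGen δ (P.symm m n) := by
  induction m with
  | zero => exact symm_zero_left n
  | succ m ih =>
    rw [← castHom_iff (Nat.add_assoc m 1 n) rfl, symm_succ_left]
    exact ((symm_one n).id_tensor m).comp ((castHom_iff _ _).2 ih.whisker)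

end StrandGen

/-! ### Evaluation of terms and the universal property of `Cocom`. -/

/-- The interpretation of formal composites in a PROP with a morphism `δ : 1 → 2`. -/
def eval (P : PROP.{u}) (δ : P.Hom 1 2) : ∀ {m n : ℕ}, Term m n → P.Hom m n
  | _, _, .id n => P.id n
  | _, _, .comp f g => P.comp (P.eval δ f) (P.eval δ g)
  | _, _, .tensor f g => P.tensor (P.eval δ f) (P.eval δ g)
  | _, _, .symm m n => P.symm m n
  | _, _, .delta => δ

theorem StrandGen.eval (δ : P.Hom 1 2) {m n : ℕ} (t : Term m n) :
    StrandGen δ (P.eval δ t) := by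
  induction t with
  | id n => exact .id n
  | comp f g ih ih' => exact ih.comp ih'
  | tensor f g ih ih' => exact ih.tensor ih'
  | symm m n => exact .symm m n
  | delta => exact .delta

theorem eval_of_rel {δ : P.Hom 1 2} (hδ : IsCocom δ) {m n : ℕ} {s t : Term m n}
    (h : CocomRel s t) : P.eval δ s = P.eval δ t := by
  have e := fun {m n m' n' : ℕ} (hm : m = m') (hn : n = n') (t : Term m n) =>
    castHom_map (H := Term) (K := P.Hom) (P.eval δ) hm hn t
  induction h with
  | refl f => rfl
  | symm _ ih => exact ih.symm
  | trans _ _ ih ih' => exact ih.trans ih'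
  | comp_congr _ _ ih ih' => exact congrArg₂ P.comp ih ih'
  | tensor_congr _ _ ih ih' => exact congrArg₂ P.tensor ih ih'
  | id_comp f => exact P.id_comp _
  | comp_id f => exact P.comp_id _
  | comp_assoc f g h => exact P.comp_assoc _ _ _
  | tensor_id m n => exact P.tensor_id _ _
  | tensor_comp f g f' g' => exact P.tensor_comp _ _ _ _
  | tensor_assoc f g h => exact (e _ _ _).trans (P.tensor_assoc _ _ _)
  | zero_tensor f => exact (e _ _ _).trans (P.zero_tensor _)
  | tensor_zero f => exact (e _ _ _).trans (P.tensor_zero _)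
  | symm_natural f g => exact P.symm_natural _ _
  | symm_symm m n => exact P.symm_symm _ _
  | symm_hexagon m n p =>
    refine (e _ _ _).trans ((P.symm_hexagon m n p).trans ?_)
    exact congrArg (fun z => P.comp z (P.tensor (P.id n) (P.symm m p)))
      (e rfl (Nat.add_assoc n m p) ((Term.symm m n).tensor (Term.id p))).symm
  | coassoc => exact hδ.coassoc
  | cocomm => exact hδ.cocomm

end PROP

open PROP

/-- The universal property of `Cocom`. -/
def Cocom.lift {P : PROP.{u}} {δ : P.Hom 1 2} (hδ : IsCocom δ) : PROPHom Cocom P where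
  map f := Quotient.lift (P.eval δ) (fun _ _ h => eval_of_rel hδ h) f
  map_id _ := rfl
  map_comp f g := by
    induction f using Quotient.ind
    induction g using Quotient.ind
    rfl
  map_tensor f g := by
    induction f using Quotient.ind
    induction g using Quotient.ind
    rfl
  map_symm _ _ := rfl

/-- Exhibits every morphism of `Cocom` as the value of a term in `Cocom` itself, so that
`StrandGen.eval` applies to it. -/
theorem Cocom.eval_delta {m n : ℕ} (t : Term m n) :
    Cocom.eval Cocom.delta t = Quotient.mk (cocomSetoid m n) t := by
  induction t with
  | comp f g ih ih' => exact congrArg₂ Cocom.comp ih ih'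
  | tensor f g ih ih' => exact congrArg₂ Cocom.tensor ih ih'
  | _ => rfl

theorem Cocom.strandGen {m n : ℕ} (f : Cocom.Hom m n) : StrandGen Cocom.delta f := by
  induction f using Quotient.ind with
  | _ t => exact Cocom.eval_delta t ▸ StrandGen.eval Cocom.delta t

theorem Cocom.isCocom_delta : IsCocom Cocom.delta where
  coassoc := Quotient.sound CocomRel.coassoc
  cocomm := Quotient.sound CocomRel.cocomm

theorem SurjOp.isCocom_delta : IsCocom SurjOp.delta where
  coassoc := Subtype.ext (funext fun _ => Subsingleton.elim (α := Fin 1) _ _)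
  cocomm := Subtype.ext (funext fun _ => Subsingleton.elim (α := Fin 1) _ _)

theorem PROPHom.map_eval {P : PROP.{u}} {Q : PROP.{v}} (F : PROPHom P Q) (δ : P.Hom 1 2) {m n : ℕ}
    (t : Term m n) : F.map (P.eval δ t) = Q.eval (F.map δ) t := by
  induction t with
  | id n => exact F.map_id n
  | comp f g ih ih' => exact (F.map_comp _ _).trans (congrArg₂ Q.comp ih ih')
  | tensor f g ih ih' => exact (F.map_tensor _ _).trans (congrArg₂ Q.tensor ih ih')
  | symm m n => exact F.map_symm m n
  | delta => rfl


/-! ### Normal forms -/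

namespace PROP

variable {P : PROP.{u}}

/-- `NormalForm δ f φ`: the morphism `f` is the canonical composite of `δ` and symmetries which
represents the surjection `φ`, built from the last output downwards. -/
inductive NormalForm (δ : P.Hom 1 2) : ∀ {m n : ℕ}, P.Hom m n → (Fin n → Fin m) → Prop
  | nil (φ : Fin 0 → Fin 0) : NormalForm δ (P.id 0) φ
  | split {m n : ℕ} {f : P.Hom m n} {φ : Fin (n + 1) → Fin m} {ψ : Fin n → Fin m} :
    NormalForm δ f ψ → (∀ x, φ x.castSucc = ψ x) →
    NormalForm δ (P.comp (splitLast δ m (φ (Fin.last n))) (P.whisker f)) φ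
  | move {m n : ℕ} {f : P.Hom m n} {φ : Fin (n + 1) → Fin (m + 1)} {ψ : Fin n → Fin m} :
    NormalForm δ f ψ → (∀ x, φ x.castSucc = (φ (Fin.last n)).succAbove (ψ x)) →
    NormalForm δ (P.comp (P.moveLast m (φ (Fin.last n))) (P.whisker f)) φ

namespace NormalForm

variable {δ : P.Hom 1 2}

theorem surjective {m n : ℕ} {f : P.Hom m n} {φ : Fin n → Fin m} (h : NormalForm δ f φ) :
    Function.Surjective φ := by
  induction h with
  | nil φ => exact fun i => i.elim0
  | split _ hφ ih =>
    intro i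
    obtain ⟨x, rfl⟩ := ih i
    exact ⟨_, hφ x⟩
  | @move m n f φ ψ _ hφ ih =>
    intro i
    rcases Fin.eq_self_or_eq_succAbove (φ (Fin.last n)) i with h | ⟨j, rfl⟩
    · exact ⟨_, h.symm⟩
    · obtain ⟨x, rfl⟩ := ih j
      exact ⟨_, hφ x⟩

/-- Needed where the duplicated strand is written as an expression only provably equal to the value
at the last output; `move'` plays the same role for moves. -/
theorem split' {m n : ℕ} {f : P.Hom m n} {φ : Fin (n + 1) → Fin m} {ψ : Fin n → Fin m}
    {i : Fin m} (h : NormalForm δ f ψ) (hi : φ (Fin.last n) = i)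
    (hφ : ∀ x, φ x.castSucc = ψ x) :
    NormalForm δ (P.comp (splitLast δ m i) (P.whisker f)) φ :=
  hi ▸ h.split hφ

theorem move' {m n : ℕ} {f : P.Hom m n} {φ : Fin (n + 1) → Fin (m + 1)} {ψ : Fin n → Fin m}
    {i : Fin (m + 1)} (h : NormalForm δ f ψ) (hi : φ (Fin.last n) = i)
    (hφ : ∀ x, φ x.castSucc = i.succAbove (ψ x)) :
    NormalForm δ (P.comp (P.moveLast m i) (P.whisker f)) φ := by
  subst hi
  exact h.move hφ

/-- The function dictates the kind of each step. In a split the input of the last output is also hit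
by an earlier output, since the inner function is surjective; in a move it is not, since `succAbove`
omits it. The inner functions are then equal too. -/
theorem unique {m n : ℕ} {f f' : P.Hom m n} {φ : Fin n → Fin m} (h : NormalForm δ f φ)
    (h' : NormalForm δ f' φ) : f = f' := by
  induction h with
  | nil φ => cases h'; rfl
  | @split m n f φ ψ h hφ ih =>
    cases h' with
    | @split _ _ f' _ ψ' h' hφ' =>
      obtain rfl : ψ = ψ' := funext fun x => (hφ x).symm.trans (hφ' x)
      rw [ih h']
    | @move m _ f' _ ψ' h' hφ' =>
      obtain ⟨x, hx⟩ := h.surjective (φ (Fin.last n))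
      exact absurd ((hφ' x).symm.trans ((hφ x).trans hx)) (Fin.succAbove_ne _ _)
  | @move m n f φ ψ h hφ ih =>
    cases h' with
    | @split _ _ f' _ ψ' h' hφ' =>
      obtain ⟨x, hx⟩ := h'.surjective (φ (Fin.last n))
      exact absurd ((hφ x).symm.trans ((hφ' x).trans hx)) (Fin.succAbove_ne _ _)
    | @move m _ f' _ ψ' h' hφ' =>
      obtain rfl : ψ = ψ' := funext fun x =>
        Fin.succAbove_right_injective ((hφ x).symm.trans (hφ' x))
      rw [ih h']

-- Delete the last output. If the remaining outputs still cover all inputs, a split is the outermost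
-- step. Otherwise the input of the last output has no other output; removing both leaves a
-- surjection, and a move is the outermost step.
variable (δ) in
theorem exists_of_surjective : ∀ {n m : ℕ} (φ : Fin n → Fin m), Function.Surjective φ →
    ∃ f : P.Hom m n, NormalForm δ f φ := by
  intro n
  induction n with
  | zero =>
    intro m φ hφ
    cases m with
    | zero => exact ⟨_, .nil φ⟩
    | succ m => exact (hφ 0).choose.elim0
  | succ n ih =>
    intro m φ hφ
    by_cases h : Function.Surjective (fun x : Fin n => φ x.castSucc)
    · obtain ⟨f, hf⟩ := ih _ h
      exact ⟨_, hf.split fun _ => rfl⟩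
    · cases m with
      | zero => exact (φ 0).elim0
      | succ m =>
        have hne : ∀ x : Fin n, φ x.castSucc ≠ φ (Fin.last n) := by
          intro x hx
          refine h fun i => ?_
          obtain ⟨y, rfl⟩ := hφ i
          induction y using Fin.lastCases with
          | last => exact ⟨x, hx⟩
          | cast y => exact ⟨y, rfl⟩
        choose ψ hψ using fun x => Fin.exists_succAbove_eq (hne x)
        have hs : Function.Surjective ψ := by
          intro i
          obtain ⟨y, hy⟩ := hφ ((φ (Fin.last n)).succAbove i)
          induction y using Fin.lastCases with
          | last => exact absurd hy.symm (Fin.succAbove_ne _ _)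
          | cast y => exact ⟨y, Fin.succAbove_right_injective ((hψ y).trans hy)⟩
        obtain ⟨f, hf⟩ := ih ψ hs
        exact ⟨_, hf.move fun x => (hψ x).symm⟩

theorem id (n : ℕ) : NormalForm δ (P.id n) _root_.id := by
  induction n with
  | zero => exact .nil _
  | succ n ih =>
    have h := ih.move' (φ := _root_.id) (i := Fin.last n) rfl
      (fun x => (Fin.succAbove_last_apply x).symm)
    rwa [moveLast_last, whisker_id, P.id_comp] at h

/-- The added strand of `whisker g` continues the last output, so the outermost step survives
unchanged and `g` is absorbed by the inner normal form. -/
theorem comp_whisker {m n p : ℕ} {f : P.Hom m (n + 1)} {g : P.Hom n p}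
    {φ : Fin (n + 1) → Fin m} {χ : Fin p → Fin n} {χ' : Fin (p + 1) → Fin (n + 1)}
    (hl : χ' (Fin.last p) = Fin.last n) (hc : ∀ x, χ' x.castSucc = (χ x).castSucc)
    (hg : ∀ {l : ℕ} {f : P.Hom l n} {φ : Fin n → Fin l}, NormalForm δ f φ →
      NormalForm δ (P.comp f g) (φ ∘ χ))
    (h : NormalForm δ f φ) : NormalForm δ (P.comp f (P.whisker g)) (φ ∘ χ') := by
  cases h with
  | split h hφ =>
    rw [P.comp_assoc, ← whisker_comp]
    exact (hg h).split' (congrArg φ hl) fun x => (congrArg φ (hc x)).trans (hφ _)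
  | move h hφ =>
    rw [P.comp_assoc, ← whisker_comp]
    exact (hg h).move' (congrArg φ hl) fun x => (congrArg φ (hc x)).trans (hφ _)

theorem comp_atLast (hδ : IsCocom δ) {m n : ℕ} {f : P.Hom m (n + 1)} {φ : Fin (n + 1) → Fin m}
    {χ : Fin (n + 2) → Fin (n + 1)} (hl : χ (Fin.last (n + 1)) = Fin.last n)
    (hc : ∀ x, χ x.castSucc = x) (h : NormalForm δ f φ) :
    NormalForm δ (P.comp f (P.atLast δ n)) (φ ∘ χ) := by
  -- The new last output has the same input as the old one, so the target normal form is forced: a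
  -- split on top of the whole old normal form. It remains to bring the composite into this shape,
  -- by `split_atLast` or `move_atLast` according to the old outermost step.
  have key : NormalForm δ (P.comp (splitLast δ m (φ (Fin.last n))) (P.whisker f)) (φ ∘ χ) :=
    h.split' (congrArg φ hl) fun x => congrArg φ (hc x)
  cases h with
  | @split m n f φ ψ h hφ =>
    rw [whisker_comp, ← P.comp_assoc] at key
    rw [P.comp_assoc, atLast_natural, ← P.comp_assoc]
    cases m with
    | zero => exact (φ (Fin.last n)).elim0
    | succ m => rwa [hδ.split_atLast]
  | @move m n f φ ψ h hφ =>
    rw [whisker_comp, ← P.comp_assoc] at key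
    rw [P.comp_assoc, atLast_natural, ← P.comp_assoc, move_atLast]
    exact key

/-- A crossing of the last two outputs slides up through the inner part `f` until it meets the two
outermost steps, where an exchange relation consumes it. -/
theorem exchange_comp {a b b' c n : ℕ} {x : P.Hom a (b + 1)} {y : P.Hom b (c + 1)}
    {x' : P.Hom a (b' + 1)} {y' : P.Hom b' (c + 1)}
    (h : P.comp x (P.comp (P.whisker y) (P.swapLast c)) = P.comp x' (P.whisker y'))
    (f : P.Hom c n) :
    P.comp (P.comp x (P.whisker (P.comp y (P.whisker f)))) (P.swapLast n) =
      P.comp x' (P.whisker (P.comp y' (P.whisker f))) := by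
  rw [whisker_comp, whisker_comp, P.comp_assoc, P.comp_assoc, swapLast_natural,
    ← P.comp_assoc (P.whisker y), ← P.comp_assoc, h, P.comp_assoc]

/-- The two outermost steps create the last two outputs, and the crossing interchanges their roles.
Each combination of splits and moves has its exchange relation, whose right side supplies the new
steps. -/
theorem comp_swapLast (hδ : IsCocom δ) {m n : ℕ} {f : P.Hom m (n + 2)}
    {φ : Fin (n + 2) → Fin m} {χ : Fin (n + 2) → Fin (n + 2)}
    (hl : χ (Fin.last (n + 1)) = (Fin.last n).castSucc)
    (hs : χ (Fin.last n).castSucc = Fin.last (n + 1))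
    (hc : ∀ x : Fin n, χ x.castSucc.castSucc = x.castSucc.castSucc) (h : NormalForm δ f φ) :
    NormalForm δ (P.comp f (P.swapLast n)) (φ ∘ χ) := by
  cases h with
  | @split _ _ f φ ψ h hφ =>
    cases h with
    | @split _ _ f ψ ρ h hψ =>
      rw [exchange_comp (hδ.split_split _ _ _)]
      -- The new inner function keeps `ρ` on the earlier outputs and takes the former value `φ
      -- (Fin.last _)` at its own last output.
      have k : NormalForm δ _ (Fin.snoc (α := fun _ => Fin m) ρ (φ (Fin.last _))) :=
        h.split' (Fin.snoc_last ..) fun x => Fin.snoc_castSucc ..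
      refine k.split' ((congrArg φ hl).trans (hφ _)) fun x => ?_
      induction x using Fin.lastCases with
      | last => exact (congrArg φ hs).trans (Fin.snoc_last (α := fun _ => Fin m) _ _).symm
      | cast x => rw [Fin.snoc_castSucc, Function.comp_apply, hc, hφ, hψ]
    | @move m _ f ψ ρ h hψ =>
      -- A split followed by a move. If the last two outputs share their input, the two steps keep
      -- their kinds and the crossing is absorbed. Otherwise the input of the last output is number
      -- `i` among those left after the move, and `move_split`, read backwards, makes the move
      -- outermost.
      rcases Fin.eq_self_or_eq_succAbove (ψ (Fin.last n)) (φ (Fin.last _)) with e | ⟨i, e⟩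
      · rw [e, exchange_comp (hδ.split_move_self _ _)]
        refine (h.move hψ).split' ((congrArg φ hl).trans (hφ _)) fun x => ?_
        induction x using Fin.lastCases with
        | last => exact (congrArg φ hs).trans e
        | cast x => exact (congrArg φ (hc x)).trans (hφ _)
      · rw [e, exchange_comp ((P.comp_assoc _ _ _).symm.trans
          (comp_swapLast_comm ((P.comp_assoc _ _ _).trans (move_split _ _ _ _))))]
        have k : NormalForm δ _ (Fin.snoc (α := fun _ => Fin m) ρ i) :=
          h.split' (Fin.snoc_last ..) fun x => Fin.snoc_castSucc ..
        refine k.move' ((congrArg φ hl).trans (hφ _)) fun x => ?_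
        induction x using Fin.lastCases with
        | last => rw [Fin.snoc_last, Function.comp_apply, hs, e]
        | cast x => rw [Fin.snoc_castSucc, Function.comp_apply, hc, hφ, hψ]
  | @move m _ f φ ψ h hφ =>
    cases h with
    | @split _ _ f ψ ρ h hψ =>
      cases m with
      | zero => exact (ψ (Fin.last n)).elim0
      | succ m =>
        rw [exchange_comp (move_split _ _ _ _)]
        have k : NormalForm δ _ (Fin.snoc (α := fun _ => Fin (m + 2))
            (fun x => (φ (Fin.last _)).succAbove (ρ x)) (φ (Fin.last _))) :=
          h.move' (Fin.snoc_last ..) fun x => Fin.snoc_castSucc ..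
        refine k.split' ((congrArg φ hl).trans (hφ _)) fun x => ?_
        induction x using Fin.lastCases with
        | last => rw [Fin.snoc_last, Function.comp_apply, hs]
        | cast x => rw [Fin.snoc_castSucc, Function.comp_apply, hc, hφ, hψ]
    | @move m _ f ψ ρ h hψ =>
      -- With two moves both inputs are renumbered; the `succAbove` and `predAbove` identities used
      -- below undo this renumbering.
      rw [exchange_comp (move_move _ _ _)]
      have k : NormalForm δ _ (Fin.snoc (α := fun _ => Fin (m + 1))
          (fun x => ((ψ (Fin.last _)).predAbove (φ (Fin.last _))).succAbove (ρ x))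
          ((ψ (Fin.last _)).predAbove (φ (Fin.last _)))) :=
        h.move' (Fin.snoc_last ..) fun x => Fin.snoc_castSucc ..
      refine k.move' ((congrArg φ hl).trans (hφ _)) fun x => ?_
      induction x using Fin.lastCases with
      | last => rw [Fin.snoc_last, Function.comp_apply, hs, Fin.succAbove_succAbove_predAbove]
      | cast x =>
        rw [Fin.snoc_castSucc, Function.comp_apply, hc, hφ, hψ,
          Fin.succAbove_succAbove_succAbove_predAbove]

end NormalForm

end PROP

/-! ### Normal forms evaluated as functions. -/

namespace SurjOp

theorem whisker_last {m n : ℕ} (f : SurjOp.Hom m n) :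
    (SurjOp.whisker f).1 (Fin.last n) = Fin.last m := finSumMap_natAdd f.1 id 0

theorem whisker_castSucc {m n : ℕ} (f : SurjOp.Hom m n) (x : Fin n) :
    (SurjOp.whisker f).1 x.castSucc = (f.1 x).castSucc := finSumMap_castAdd f.1 id x

theorem swapLast_last (n : ℕ) :
    (SurjOp.swapLast n).1 (Fin.last (n + 1)) = (Fin.last n).castSucc :=
  finSumMap_natAdd (n := n) (m' := 2) (n' := 2) id (SurjOp.symm 1 1).1 1

theorem swapLast_castSucc_last (n : ℕ) :
    (SurjOp.swapLast n).1 (Fin.last n).castSucc = Fin.last (n + 1) :=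
  finSumMap_natAdd (n := n) (m' := 2) (n' := 2) id (SurjOp.symm 1 1).1 0

theorem swapLast_castSucc_castSucc (n : ℕ) (x : Fin n) :
    (SurjOp.swapLast n).1 x.castSucc.castSucc = x.castSucc.castSucc :=
  finSumMap_castAdd (n := n) (m' := 2) (n' := 2) id (SurjOp.symm 1 1).1 x

theorem atLast_last (n : ℕ) :
    (SurjOp.atLast SurjOp.delta n).1 (Fin.last (n + 1)) = Fin.last n :=
  finSumMap_natAdd (n := n) (n' := 2) id SurjOp.delta.1 1

theorem atLast_castSucc (n : ℕ) (x : Fin (n + 1)) :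
    (SurjOp.atLast SurjOp.delta n).1 x.castSucc = x := by
  induction x using Fin.lastCases with
  | last => exact finSumMap_natAdd (n := n) (n' := 2) id SurjOp.delta.1 0
  | cast x => exact finSumMap_castAdd (n := n) (n' := 2) id SurjOp.delta.1 x

theorem moveLast_apply {k : ℕ} (i : Fin (k + 1)) : (SurjOp.moveLast k i).1 (Fin.last k) = i ∧
    ∀ x, (SurjOp.moveLast k i).1 x.castSucc = i.succAbove x := by
  have last : ∀ k, (SurjOp.moveLast k (Fin.last k)).1 (Fin.last k) = Fin.last k ∧
      ∀ x, (SurjOp.moveLast k (Fin.last k)).1 x.castSucc = (Fin.last k).succAbove x := by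
    intro k
    rw [moveLast_last]
    exact ⟨rfl, fun x => (Fin.succAbove_last_apply x).symm⟩
  induction k with
  | zero =>
    obtain rfl : i = Fin.last 0 := Fin.fin_one_eq_zero i
    exact last 0
  | succ k ih =>
    induction i using Fin.lastCases with
    | last => exact last (k + 1)
    | cast i =>
      rw [moveLast_castSucc]
      have e : ∀ y, (SurjOp.comp (SurjOp.whisker (SurjOp.moveLast k i)) (SurjOp.swapLast k)).1 y =
        (SurjOp.whisker (SurjOp.moveLast k i)).1 ((SurjOp.swapLast k).1 y) := fun _ => rfl
      refine ⟨?_, fun x => ?_⟩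
      · rw [e, swapLast_last, whisker_castSucc, (ih i).1]
      · induction x using Fin.lastCases with
        | last =>
          rw [e, swapLast_castSucc_last, whisker_last,
            Fin.succAbove_ne_last_last (Fin.castSucc_ne_last i)]
        | cast x =>
          rw [e, swapLast_castSucc_castSucc, whisker_castSucc, (ih i).2,
            Fin.castSucc_succAbove_castSucc]

theorem splitLast_apply {k : ℕ} (i : Fin k) :
    (splitLast SurjOp.delta k i).1 (Fin.last k) = i ∧
      ∀ x, (splitLast SurjOp.delta k i).1 x.castSucc = x := by
  induction k with
  | zero => exact i.elim0
  | succ k ih =>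
    induction i using Fin.lastCases with
    | last =>
      rw [splitLast_last]
      exact ⟨atLast_last k, atLast_castSucc k⟩
    | cast i =>
      rw [splitLast_castSucc]
      have e : ∀ y, (SurjOp.comp (SurjOp.whisker (splitLast SurjOp.delta k i))
        (SurjOp.swapLast k)).1 y = (SurjOp.whisker (splitLast SurjOp.delta k i)).1
          ((SurjOp.swapLast k).1 y) := fun _ => rfl
      refine ⟨?_, fun x => ?_⟩
      · rw [e, swapLast_last, whisker_castSucc, (ih i).1]
      · induction x using Fin.lastCases with
        | last => rw [e, swapLast_castSucc_last, whisker_last]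
        | cast x => rw [e, swapLast_castSucc_castSucc, whisker_castSucc, (ih i).2]

/-- Confirms that a normal form represents its function. Together with `PROPHom.map_normalForm` this
yields fullness of `Cocom.toSurjOp`. -/
theorem eq_of_normalForm {m n : ℕ} {f : SurjOp.Hom m n} {φ : Fin n → Fin m}
    (h : NormalForm SurjOp.delta f φ) : f.1 = φ := by
  induction h with
  | nil φ => exact funext fun i => i.elim0
  | @split m n f φ ψ h hφ ih =>
    funext x
    change (splitLast SurjOp.delta m _).1 ((SurjOp.whisker f).1 x) = _
    induction x using Fin.lastCases with
    | last => rw [whisker_last, (splitLast_apply _).1]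
    | cast x => rw [whisker_castSucc, (splitLast_apply _).2, hφ, ih]
  | @move m n f φ ψ h hφ ih =>
    funext x
    change (SurjOp.moveLast m _).1 ((SurjOp.whisker f).1 x) = _
    induction x using Fin.lastCases with
    | last => rw [whisker_last, (moveLast_apply _).1]
    | cast x => rw [whisker_castSucc, (moveLast_apply _).2, hφ, ih]

end SurjOp

/-! ### `Cocom` and surjections -/

namespace PROPHom

variable {P : PROP.{u}} {Q : PROP.{v}} (F : PROPHom P Q)

theorem map_whisker {m n : ℕ} (f : P.Hom m n) : F.map (P.whisker f) = Q.whisker (F.map f) :=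
  (F.map_tensor f (P.id 1)).trans (congrArg (Q.tensor (F.map f)) (F.map_id 1))

theorem map_swapLast (n : ℕ) : F.map (P.swapLast n) = Q.swapLast n :=
  (F.map_tensor (P.id n) (P.symm 1 1)).trans (congrArg₂ Q.tensor (F.map_id n) (F.map_symm 1 1))

theorem map_atLast (δ : P.Hom 1 2) (n : ℕ) : F.map (P.atLast δ n) = Q.atLast (F.map δ) n :=
  (F.map_tensor (P.id n) δ).trans (congrArg (Q.tensor · (F.map δ)) (F.map_id n))

theorem map_moveLast {k : ℕ} (i : Fin (k + 1)) : F.map (P.moveLast k i) = Q.moveLast k i := by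
  induction k with
  | zero => exact F.map_id 1
  | succ k ih =>
    induction i using Fin.lastCases with
    | last => rw [moveLast_last, moveLast_last, F.map_id]
    | cast i =>
      rw [moveLast_castSucc, moveLast_castSucc, F.map_comp, map_whisker, map_swapLast, ih]

theorem map_splitLast (δ : P.Hom 1 2) {k : ℕ} (i : Fin k) :
    F.map (splitLast δ k i) = splitLast (F.map δ) k i := by
  induction k with
  | zero => exact i.elim0
  | succ k ih =>
    induction i using Fin.lastCases with
    | last => rw [splitLast_last, splitLast_last, map_atLast]
    | cast i =>
      rw [splitLast_castSucc, splitLast_castSucc, F.map_comp, map_whisker, map_swapLast, ih]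

theorem map_normalForm {δ : P.Hom 1 2} {m n : ℕ} {f : P.Hom m n} {φ : Fin n → Fin m}
    (h : NormalForm δ f φ) : NormalForm (F.map δ) (F.map f) φ := by
  induction h with
  | nil φ => rw [F.map_id]; exact .nil φ
  | split _ hφ ih => rw [F.map_comp, map_splitLast, map_whisker]; exact ih.split hφ
  | move _ hφ ih => rw [F.map_comp, map_moveLast, map_whisker]; exact ih.move hφ

end PROPHom

section

variable {P : PROP.{u}} {δ : P.Hom 1 2} (F : PROPHom P SurjOp)

/-- The statement ranges over all normal forms `f` with target `m`, so that the induction passes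
through composites and whiskerings. -/
theorem PROP.StrandGen.normalForm_comp (hδ : IsCocom δ) (hF : F.map δ = SurjOp.delta) {m n : ℕ} {g : P.Hom m n}
    (hg : StrandGen δ g) : ∀ {l : ℕ} {f : P.Hom l m} {φ : Fin m → Fin l}, NormalForm δ f φ →
      NormalForm δ (P.comp f g) (φ ∘ (F.map g).1) := by
  induction hg with
  | id n =>
    intro l f φ h
    rw [P.comp_id, F.map_id]
    exact h
  | comp _ _ ih ih' =>
    intro l f φ h
    rw [← P.comp_assoc, F.map_comp]
    exact ih' (ih h)
  | whisker _ ih =>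
    intro l f φ h
    rw [F.map_whisker]
    exact h.comp_whisker (SurjOp.whisker_last _) (SurjOp.whisker_castSucc _) ih
  | swapLast n =>
    intro l f φ h
    rw [F.map_swapLast]
    exact h.comp_swapLast hδ (SurjOp.swapLast_last n) (SurjOp.swapLast_castSucc_last n)
      (SurjOp.swapLast_castSucc_castSucc n)
  | atLast n =>
    intro l f φ h
    rw [F.map_atLast, hF]
    exact h.comp_atLast hδ (SurjOp.atLast_last n) (SurjOp.atLast_castSucc n)

/-- Composing the normal form of the identity with `f` shows that `f` is the normal form of its own
image. -/
theorem PROP.StrandGen.normalForm (hδ : IsCocom δ) (hF : F.map δ = SurjOp.delta) {m n : ℕ}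
    {f : P.Hom m n} (hf : StrandGen δ f) : NormalForm δ f (F.map f).1 := by
  have h := hf.normalForm_comp F hδ hF (.id m)
  rwa [P.id_comp] at h

end

/-- The functor from `Cocom` to surjections which preserves the generator. -/
def Cocom.toSurjOp : PROPHom Cocom SurjOp := Cocom.lift SurjOp.isCocom_delta

theorem Cocom.toSurjOp_delta : Cocom.toSurjOp.map Cocom.delta = SurjOp.delta := rfl

theorem Cocom.toSurjOp_injective (m n : ℕ) :
    Function.Injective (Cocom.toSurjOp.map : Cocom.Hom m n → SurjOp.Hom m n) := by
  intro f g h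
  -- Both morphisms are normal forms of the same surjection, hence equal.
  have hf := (Cocom.strandGen f).normalForm toSurjOp isCocom_delta toSurjOp_delta
  rw [h] at hf
  exact hf.unique ((Cocom.strandGen g).normalForm toSurjOp isCocom_delta toSurjOp_delta)

theorem Cocom.toSurjOp_surjective (m n : ℕ) :
    Function.Surjective (Cocom.toSurjOp.map : Cocom.Hom m n → SurjOp.Hom m n) := by
  rintro ⟨φ, hφ⟩
  obtain ⟨f, hf⟩ := NormalForm.exists_of_surjective Cocom.delta φ hφ
  exact ⟨f, Subtype.ext (SurjOp.eq_of_normalForm (toSurjOp.map_normalForm hf))⟩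

/-! ### Surjections as corelations -/

namespace SurjOp

variable {m n p : ℕ}

/-- The corelation in which an output is equivalent exactly to the inputs and outputs with the
same image. -/
@[reducible] def corel (φ : Fin n → Fin m) : Corel m n := Setoid.ker (Sum.elim id φ)

/-- A labelling is constant on classes iff the output labels are pulled back along `φ`. Through
`Corel.ext_sat`, identities between such corelations become identities between labellings. -/
theorem sat_corel {φ : Fin n → Fin m} {Z : Type} {a : Fin m → Z} {b : Fin n → Z} :
    Corel.Sat (corel φ) a b ↔ ∀ j, b j = a (φ j) := by
  constructor
  · intro H j
    exact H (inr j) (inl (φ j)) rfl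
  · intro H x y hxy
    have k : ∀ x, Sum.elim a b x = a (Sum.elim id φ x) := by
      rintro (x | x)
      · rfl
      · exact H x
    rw [k, k]
    exact congrArg a hxy

theorem corel_comp (φ : Fin n → Fin m) (ψ : Fin p → Fin n) :
    corel (φ ∘ ψ) = Corel.comp (corel φ) (corel ψ) :=
  Corel.ext_sat fun Z a c => by
    rw [sat_corel]
    constructor
    · intro H
      exact Corel.sat_comp (b := a ∘ φ) (sat_corel.2 fun _ => rfl) (sat_corel.2 H)
    · intro H
      -- The middle labels lie in `Option Z`, because a glued class may miss the outer boundary;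
      -- injectivity of `some` brings the conclusion back to `Z`.
      obtain ⟨b, h₁, h₂⟩ := Corel.exists_of_sat_comp H
      rw [sat_corel] at h₁ h₂
      exact fun j => Option.some_injective Z ((h₂ j).trans (h₁ (ψ j)))

theorem corel_injective : Function.Injective (corel : (Fin n → Fin m) → Corel m n) := by
  intro φ ψ h
  funext j
  have k : corel ψ (inr j) (inl (φ j)) := h ▸ (rfl : Sum.elim id φ (inr j) = _)
  exact Eq.symm k

theorem corel_tensor {m' n' : ℕ} (φ : Fin n → Fin m) (ψ : Fin n' → Fin m') :
    corel (finSumMap φ ψ) = Corel.tensor (corel φ) (corel ψ) :=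
  Corel.ext_sat fun Z a b => by
    rw [Corel.sat_tensor, sat_corel, sat_corel, sat_corel]
    constructor
    · intro H
      exact ⟨fun j => (H _).trans (congrArg a (finSumMap_castAdd φ ψ j)),
        fun j => (H _).trans (congrArg a (finSumMap_natAdd φ ψ j))⟩
    · rintro ⟨h, h'⟩ j
      induction j using Fin.addCases with
      | left j => exact (h j).trans (congrArg a (finSumMap_castAdd φ ψ j).symm)
      | right j => exact (h' j).trans (congrArg a (finSumMap_natAdd φ ψ j).symm)

theorem corel_equiv (e : Fin m ≃ Fin n) : corel e.symm = Corel.ofEquiv e :=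
  Corel.ext_sat fun Z a b => by
    rw [Corel.sat_ofEquiv, sat_corel]
    exact ⟨fun H i => by simpa using (H (e i)).symm, fun H j => by simpa using (H (e.symm j)).symm⟩

theorem finAddFlip_symm (m n : ℕ) :
    (finAddFlip : Fin (m + n) ≃ Fin (n + m)).symm = finAddFlip := by
  ext1 j
  rw [Equiv.symm_apply_eq]
  induction j using Fin.addCases <;> simp

/-- Surjections as corelations, functorially. -/
def toFinCorel : PROPHom SurjOp FinCorel where
  map φ := corel φ.1
  map_id n := corel_equiv (Equiv.refl (Fin n))
  map_comp f g := corel_comp f.1 g.1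
  map_tensor f g := corel_tensor f.1 g.1
  map_symm m n := (congrArg (fun e : Fin (n + m) ≃ Fin (m + n) => corel e)
    (finAddFlip_symm m n)).symm.trans (corel_equiv finAddFlip)

theorem corel_isCirc {φ : Fin n → Fin m} (hφ : Function.Surjective φ) : (corel φ).IsCirc := by
  constructor
  · rintro _ ⟨y, rfl⟩
    exact ⟨Sum.elim id φ y, rfl, fun i hi => hi⟩
  · rintro _ ⟨y, rfl⟩
    obtain ⟨j, hj⟩ := hφ (Sum.elim id φ y)
    exact ⟨j, hj⟩

/-- Condition (a) lets `φ` send an output to the only input in its class. Condition (b), applied to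
the class of an input, makes `φ` surjective. Each element is related to its designated input, so
being related means having the same designated input. -/
theorem exists_corel_eq {R : Corel m n} (hR : R.IsCirc) :
    ∃ φ : Fin n → Fin m, Function.Surjective φ ∧ corel φ = R := by
  have h₁ : ∀ x, ∃! i : Fin m, R (inl i) x := fun x => hR.1 {y | R y x} (R.mem_classes x)
  have h₂ : ∀ x, ∃ j : Fin n, R (inr j) x := fun x => hR.2 {y | R y x} (R.mem_classes x)
  choose φ hφ using fun j => (h₁ (inr j)).exists
  have k : ∀ x, R (inl (Sum.elim id φ x)) x := by
    rintro (x | x)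
    · exact R.refl _
    · exact hφ x
  refine ⟨φ, fun i => ?_, ?_⟩
  · obtain ⟨j, hj⟩ := h₂ (inl i)
    exact ⟨j, (h₁ (inl i)).unique (R.trans (hφ j) hj) (R.refl _)⟩
  · ext x y
    constructor
    · intro h
      exact R.trans (R.symm (k x)) ((show Sum.elim id φ x = Sum.elim id φ y from h) ▸ k y)
    · intro h
      exact (h₁ y).unique (R.trans (k x) h) (k y)

end SurjOp

/-- The sub-PROP `FinCorel°`. -/
def finCorelCirc : SubPROP FinCorel where
  carrier m n := {R : Corel m n | R.IsCirc}
  id_mem n := by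
    rw [← SurjOp.toFinCorel.map_id]
    exact SurjOp.corel_isCirc (SurjOp.id n).2
  -- Closure is inherited from surjections, whose composites and disjoint unions are surjective.
  comp_mem hf hg := by
    obtain ⟨φ, hφ, rfl⟩ := SurjOp.exists_corel_eq hf
    obtain ⟨ψ, hψ, rfl⟩ := SurjOp.exists_corel_eq hg
    exact (SurjOp.corel_comp φ ψ).subst (motive := Corel.IsCirc)
      (SurjOp.corel_isCirc (hφ.comp hψ))
  tensor_mem {m n m' n' f g} hf hg := by
    obtain ⟨φ, hφ, rfl⟩ := SurjOp.exists_corel_eq hf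
    obtain ⟨ψ, hψ, rfl⟩ := SurjOp.exists_corel_eq hg
    exact (SurjOp.toFinCorel.map_tensor (⟨φ, hφ⟩ : SurjOp.Hom m n)
      (⟨ψ, hψ⟩ : SurjOp.Hom m' n')).subst (motive := Corel.IsCirc)
        (SurjOp.corel_isCirc (finSumMap_surjective hφ hψ))
  symm_mem m n := by
    rw [← SurjOp.toFinCorel.map_symm]
    exact SurjOp.corel_isCirc (SurjOp.symm m n).2

/-! ### Isomorphisms of PROPs -/

/-- A bijective morphism of PROPs is an isomorphism. -/
noncomputable def PROPIso.ofBijective {P : PROP.{u}} {Q : PROP.{v}} (F : PROPHom P Q)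
    (h : ∀ m n, Function.Injective (F.map : P.Hom m n → Q.Hom m n))
    (h' : ∀ m n, Function.Surjective (F.map : P.Hom m n → Q.Hom m n)) : PROPIso P Q where
  hom := F
  inv :=
    { map := fun {m n} => Function.surjInv (h' m n)
      map_id := fun n => h _ _ ((Function.surjInv_eq (h' n n) _).trans (F.map_id n).symm)
      map_comp := fun f g => h _ _ ((Function.surjInv_eq (h' _ _) _).trans
        ((F.map_comp _ _).trans (congrArg₂ Q.comp (Function.surjInv_eq (h' _ _) f)
          (Function.surjInv_eq (h' _ _) g))).symm)
      map_tensor := fun f g => h _ _ ((Function.surjInv_eq (h' _ _) _).trans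
        ((F.map_tensor _ _).trans (congrArg₂ Q.tensor (Function.surjInv_eq (h' _ _) f)
          (Function.surjInv_eq (h' _ _) g))).symm)
      map_symm := fun m n => h _ _ ((Function.surjInv_eq (h' _ _) _).trans (F.map_symm m n).symm) }
  inv_hom _ := h _ _ (Function.surjInv_eq (h' _ _) _)
  hom_inv g := Function.surjInv_eq (h' _ _) g

/-- Composition of morphisms of PROPs. -/
def PROPHom.comp {P : PROP.{u}} {Q : PROP.{v}} {R : PROP.{w}} (G : PROPHom Q R)
    (F : PROPHom P Q) : PROPHom P R where
  map f := G.map (F.map f)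
  map_id n := by rw [F.map_id, G.map_id]
  map_comp f g := by rw [F.map_comp, G.map_comp]
  map_tensor f g := by rw [F.map_tensor, G.map_tensor]
  map_symm m n := by rw [F.map_symm, G.map_symm]

/-- Composition of isomorphisms of PROPs, the second one being reversed. -/
def PROPIso.transSymm {P : PROP.{u}} {Q : PROP.{v}} {R : PROP.{w}} (F : PROPIso P R)
    (G : PROPIso Q R) : PROPIso P Q where
  hom := G.inv.comp F.hom
  inv := F.inv.comp G.hom
  inv_hom f := (congrArg F.inv.map (G.hom_inv _)).trans (F.inv_hom f)
  hom_inv g := (congrArg G.inv.map (F.hom_inv _)).trans (G.inv_hom g)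

/-- Restriction of the codomain of a morphism of PROPs. -/
def PROPHom.codRestrict {P : PROP.{u}} {Q : PROP.{v}} (F : PROPHom P Q) (S : SubPROP Q)
    (h : ∀ {m n : ℕ} (f : P.Hom m n), F.map f ∈ S.carrier m n) : PROPHom P S.toPROP where
  map f := ⟨F.map f, h f⟩
  map_id n := Subtype.ext (F.map_id n)
  map_comp f g := Subtype.ext (F.map_comp f g)
  map_tensor f g := Subtype.ext (F.map_tensor f g)
  map_symm m n := Subtype.ext (F.map_symm m n)

/-- The morphism induced on the quotient by the kernel congruence. -/
def kerQuot.lift {P : PROP.{u}} {Q : PROP.{v}} (F : PROPHom P Q) : PROPHom (kerQuot F) Q where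
  map f := Quotient.lift F.map (fun _ _ h => h) f
  map_id n := F.map_id n
  map_comp f g := by
    induction f using Quotient.ind
    induction g using Quotient.ind
    exact F.map_comp _ _
  map_tensor f g := by
    induction f using Quotient.ind
    induction g using Quotient.ind
    exact F.map_tensor _ _
  map_symm m n := F.map_symm m n

theorem kerQuot.lift_injective {P : PROP.{u}} {Q : PROP.{v}} (F : PROPHom P Q) (m n : ℕ) :
    Function.Injective ((kerQuot.lift F).map : (kerQuot F).Hom m n → Q.Hom m n) := by
  intro f g h
  induction f using Quotient.ind
  induction g using Quotient.ind
  exact Quotient.sound h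

/-- The first isomorphism theorem for PROPs. -/
noncomputable def kerQuot.isoImage {P : PROP.{u}} {Q : PROP.{v}} (F : PROPHom P Q) (S : SubPROP Q)
    (h : ∀ (m n : ℕ) (g : Q.Hom m n), (∃ f : P.Hom m n, F.map f = g) ↔ g ∈ S.carrier m n) :
    PROPIso (kerQuot F) S.toPROP :=
  PROPIso.ofBijective ((kerQuot.lift F).codRestrict S fun {m n} f => by
      induction f using Quotient.ind with
      | _ f => exact (h m n _).1 ⟨f, rfl⟩)
    (fun m n _ _ k => kerQuot.lift_injective F m n (congrArg Subtype.val k))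
    (fun m n g => by
      obtain ⟨f, hf⟩ := (h m n g.1).2 g.2
      exact ⟨Quotient.mk _ f, Subtype.ext hf⟩)

/-! ### The ancestry functor -/

namespace Diagram

variable {m n : ℕ}

/-- `r` and `φ` assign to the vertices and the outputs the inputs from which they descend. -/
def IsRoot (G : Diagram m n) (r : G.V → Fin m) (φ : Fin n → Fin m) : Prop :=
  ∀ s, Sum.elim φ r (G.wire s) = Sum.elim id (fun x => r x.1) s

/-- There is a wire from the first vertex to the second. -/
def Parent (G : Diagram m n) (a b : G.V) : Prop := ∃ s, G.wire (inr (a, s)) = inr b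

theorem wellFounded_parent (G : Diagram m n) : WellFounded G.Parent := by
  have := G.finite
  have : Std.Irrefl (Relation.TransGen G.Parent) := ⟨G.acyclic⟩
  exact Subrelation.wf (fun h => Relation.TransGen.single h)
    (Finite.wellFounded_of_trans_of_irrefl (Relation.TransGen G.Parent))

theorem wellFounded_child (G : Diagram m n) : WellFounded (Function.swap G.Parent) := by
  have := G.finite
  have : Std.Irrefl (Relation.TransGen G.Parent) := ⟨G.acyclic⟩
  exact Subrelation.wf (r := Function.swap (Relation.TransGen G.Parent))
    (fun h => Relation.TransGen.single h)
    (Finite.wellFounded_of_trans_of_irrefl (Function.swap (Relation.TransGen G.Parent)))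

/-- Since the wiring is a bijection, its inverse gives the one wire ending at a vertex; the root is
defined by well-founded recursion along these backward steps. -/
theorem exists_isRoot (G : Diagram m n) : ∃ r φ, G.IsRoot r φ := by
  let F : ∀ v : G.V, (∀ u, G.Parent u v → Fin m) → Fin m := fun v rec =>
    match h : G.wire.symm (inr v) with
    | inl i => i
    | inr (u, s) => rec u ⟨s, by rw [← h, Equiv.apply_symm_apply]⟩
  let r : G.V → Fin m := G.wellFounded_parent.fix F
  have hr : ∀ v, r v = Sum.elim id (fun x => r x.1) (G.wire.symm (inr v)) := by
    intro v
    refine (G.wellFounded_parent.fix_eq F v).trans ?_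
    simp only [F]
    split <;> rename_i h <;> rw [h] <;> rfl
  refine ⟨r, fun j => Sum.elim id (fun x => r x.1) (G.wire.symm (inl j)), fun s => ?_⟩
  rcases h : G.wire s with j | v
  · rw [← G.wire.symm_apply_eq.2 h.symm]; rfl
  · rw [← G.wire.symm_apply_eq.2 h.symm]; exact hr v

namespace IsRoot

variable {G : Diagram m n} {r : G.V → Fin m} {φ : Fin n → Fin m}

/-- Follow a wire from the input and then left outgoing half-edges. Acyclicity and finiteness make
this walk reach an output, and the root does not change on the way. -/
theorem surjective (h : G.IsRoot r φ) : Function.Surjective φ := by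
  have key : ∀ v, ∃ j, φ j = r v := by
    intro v
    induction v using G.wellFounded_child.induction with
    | _ v ih =>
      have hv := h (inr (v, false))
      rcases e : G.wire (inr (v, false)) with j | w
      · rw [e] at hv
        exact ⟨j, hv⟩
      · rw [e] at hv
        obtain ⟨j, hj⟩ := ih w ⟨false, e⟩
        exact ⟨j, hj.trans hv⟩
  intro i
  have hi := h (inl i)
  rcases e : G.wire (inl i) with j | w
  · rw [e] at hi
    exact ⟨j, hi⟩
  · rw [e] at hi
    obtain ⟨j, hj⟩ := key w
    exact ⟨j, hj.trans hi⟩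

theorem reachable_wire (G : Diagram m n) (s : Fin m ⊕ G.V × Bool) :
    G.underlying.Reachable (G.srcNode s) (G.tgtNode (G.wire s)) := by
  by_cases e : G.srcNode s = G.tgtNode (G.wire s)
  · rw [e]
  · exact SimpleGraph.Adj.reachable ((SimpleGraph.fromRel_adj _ _ _).2 ⟨e, .inl ⟨s, rfl, rfl⟩⟩)

/-- The root labelling `L` is preserved by each wire, so connected nodes have equal roots.
Conversely every node is joined to its root by well-founded induction on parents, so equal roots
imply connectedness. -/
theorem ancestry_eq (h : G.IsRoot r φ) : G.ancestry = SurjOp.corel φ := by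
  let L : (Fin m ⊕ Fin n) ⊕ G.V → Fin m := Sum.elim (Sum.elim id φ) r
  have hw : ∀ s, L (G.srcNode s) = L (G.tgtNode (G.wire s)) := by
    intro s
    have e₁ : L (G.srcNode s) = Sum.elim id (fun x => r x.1) s := by rcases s with i | v <;> rfl
    have e₂ : ∀ t, L (G.tgtNode t) = Sum.elim φ r t := by rintro (j | v) <;> rfl
    rw [e₁, e₂, h]
  have hL : ∀ x y, G.underlying.Reachable x y → L x = L y := by
    rintro x y ⟨p⟩
    induction p with
    | nil => rfl
    | cons hxy _ ih =>
      refine Eq.trans ?_ ih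
      obtain ⟨-, ⟨s, rfl, rfl⟩ | ⟨s, rfl, rfl⟩⟩ := (SimpleGraph.fromRel_adj _ _ _).1 hxy
      · exact hw s
      · exact (hw s).symm
  have hv : ∀ v, G.underlying.Reachable (inl (inl (r v))) (inr v) := by
    intro v
    induction v using G.wellFounded_parent.induction with
    | _ v ih =>
      obtain ⟨s, hs⟩ := G.wire.surjective (inr v)
      have k := reachable_wire G s
      have l := h s
      rw [hs] at k l
      rcases s with i | ⟨u, s⟩
      · change r v = i at l
        exact l ▸ k
      · change r v = r u at l
        exact l ▸ (ih u ⟨s, hs⟩).trans k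
  have hx : ∀ x : Fin m ⊕ Fin n,
      G.underlying.Reachable (inl (inl (Sum.elim id φ x))) (inl x) := by
    rintro (i | j)
    · exact SimpleGraph.Reachable.refl _
    · obtain ⟨s, hs⟩ := G.wire.surjective (inl j)
      have k := reachable_wire G s
      have l := h s
      rw [hs] at k l
      rcases s with i | ⟨u, s⟩
      · change φ j = i at l
        change G.underlying.Reachable (inl (inl (φ j))) _
        exact l ▸ k
      · change φ j = r u at l
        change G.underlying.Reachable (inl (inl (φ j))) _
        exact l ▸ (hv u).trans k
  ext x y
  constructor
  · exact fun k => hL _ _ k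
  · intro k
    have k : Sum.elim id φ x = Sum.elim id φ y := k
    exact (hx x).symm.trans (k ▸ hx y)

theorem ofEquiv (e : Fin m ≃ Fin n) : (Diagram.ofEquiv e).IsRoot (fun v => v.elim) e.symm := by
  rintro (i | ⟨v, -⟩)
  · exact e.symm_apply_apply i
  · exact v.elim

/-- Tracing back from the second diagram stops at one of its inputs, an output of the first diagram,
where `φ` continues the trace. -/
theorem comp {p : ℕ} {H : Diagram n p} {r' : H.V → Fin n} {ψ : Fin p → Fin n}
    (h : G.IsRoot r φ) (h' : H.IsRoot r' ψ) :
    (G.comp H).IsRoot (Sum.elim r (φ ∘ r')) (φ ∘ ψ) := by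
  have e : ∀ t, Sum.elim (φ ∘ ψ) (Sum.elim r (φ ∘ r')) (Sum.map id inr t) =
      φ (Sum.elim ψ r' t) := by rintro (k | w) <;> rfl
  have e' : ∀ t, Sum.elim (φ ∘ ψ) (Sum.elim r (φ ∘ r')) (Wiring.bridge G.V H.wire t) =
      Sum.elim φ r t := by
    rintro (j | v)
    · exact (e _).trans (congrArg φ (h' (inl j)))
    · rfl
  rintro (i | ⟨v | w, s⟩)
  · exact (congrArg _ (Wiring.comp_inl G.wire H.wire i)).trans ((e' _).trans (h _))
  · exact (congrArg _ (Wiring.comp_inr_inl G.wire H.wire v s)).trans ((e' _).trans (h _))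
  · exact (congrArg _ (Wiring.comp_inr_inr G.wire H.wire w s)).trans
      ((e _).trans (congrArg φ (h' _)))

theorem tensor {m' n' : ℕ} {H : Diagram m' n'} {r' : H.V → Fin m'} {ψ : Fin n' → Fin m'}
    (h : G.IsRoot r φ) (h' : H.IsRoot r' ψ) :
    (G.tensor H).IsRoot (Sum.elim (Fin.castAdd m' ∘ r) (Fin.natAdd m ∘ r'))
      (finSumMap φ ψ) := by
  have e : ∀ t, Sum.elim (finSumMap φ ψ) (Sum.elim (Fin.castAdd m' ∘ r) (Fin.natAdd m ∘ r'))
      (Sum.map (Fin.castAdd n') inl t) = Fin.castAdd m' (Sum.elim φ r t) := by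
    rintro (k | w)
    · exact finSumMap_castAdd φ ψ k
    · rfl
  have e' : ∀ t, Sum.elim (finSumMap φ ψ) (Sum.elim (Fin.castAdd m' ∘ r) (Fin.natAdd m ∘ r'))
      (Sum.map (Fin.natAdd n) inr t) = Fin.natAdd m (Sum.elim ψ r' t) := by
    rintro (k | w)
    · exact finSumMap_natAdd φ ψ k
    · rfl
  rintro (i | ⟨v | w, s⟩)
  · induction i using Fin.addCases with
    | left i =>
      exact (congrArg _ (Wiring.tensor_castAdd G.wire H.wire i)).trans
        ((e _).trans (congrArg _ (h _)))
    | right i =>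
      exact (congrArg _ (Wiring.tensor_natAdd G.wire H.wire i)).trans
        ((e' _).trans (congrArg _ (h' _)))
  · exact (congrArg _ (Wiring.tensor_inr_inl G.wire H.wire v s)).trans
      ((e _).trans (congrArg _ (h _)))
  · exact (congrArg _ (Wiring.tensor_inr_inr G.wire H.wire w s)).trans
      ((e' _).trans (congrArg _ (h' _)))

end IsRoot

end Diagram

theorem ancestry_ofEquiv {m n : ℕ} (e : Fin m ≃ Fin n) :
    (Diagram.ofEquiv e).ancestry = Corel.ofEquiv e :=
  (Diagram.IsRoot.ofEquiv e).ancestry_eq.trans (SurjOp.corel_equiv e)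

/-- The ancestry functor. -/
def ancestryHom : PROPHom Syn FinCorel where
  map := ancestry
  map_id n := ancestry_ofEquiv (Equiv.refl (Fin n))
  map_comp f g := by
    induction f using Quotient.ind with
    | _ G =>
      induction g using Quotient.ind with
      | _ H =>
        obtain ⟨r, φ, h⟩ := G.exists_isRoot
        obtain ⟨r', ψ, h'⟩ := H.exists_isRoot
        exact (h.comp h').ancestry_eq.trans ((SurjOp.corel_comp φ ψ).trans
          (congrArg₂ Corel.comp h.ancestry_eq h'.ancestry_eq).symm)
  map_tensor f g := by
    induction f using Quotient.ind with
    | _ G =>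
      induction g using Quotient.ind with
      | _ H =>
        obtain ⟨r, φ, h⟩ := G.exists_isRoot
        obtain ⟨r', ψ, h'⟩ := H.exists_isRoot
        exact (h.tensor h').ancestry_eq.trans ((SurjOp.corel_tensor φ ψ).trans
          (congrArg₂ Corel.tensor h.ancestry_eq h'.ancestry_eq).symm)
  map_symm m n := ancestry_ofEquiv finAddFlip

/-- The root function need not be computed: there is only one function into a one-element set. -/
theorem ancestryHom_delta : ancestryHom.map Syn.delta = SurjOp.toFinCorel.map SurjOp.delta := by
  obtain ⟨r, φ, h⟩ := Diagram.delta.exists_isRoot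
  refine h.ancestry_eq.trans (congrArg SurjOp.corel ?_)
  exact funext fun _ => Subsingleton.elim (α := Fin 1) _ _

/-! ### The image of the ancestry functor and the resulting isomorphisms. -/

theorem exists_ancestryHom_iff {m n : ℕ} (R : Corel m n) :
    (∃ f : Syn.Hom m n, ancestryHom.map f = R) ↔ R.IsCirc := by
  constructor
  · rintro ⟨f, rfl⟩
    induction f using Quotient.ind with
    | _ G =>
      obtain ⟨r, φ, h⟩ := G.exists_isRoot
      exact h.ancestry_eq.symm.subst (motive := Corel.IsCirc) (SurjOp.corel_isCirc h.surjective)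
  · intro hR
    obtain ⟨φ, hφ, rfl⟩ := SurjOp.exists_corel_eq hR
    -- The surjection is the value of some term in `SurjOp`. Evaluating the same term in `Syn` gives
    -- the required diagram class, because `ancestryHom` and `SurjOp.toFinCorel` agree on the
    -- generators.
    obtain ⟨f, hf⟩ := Cocom.toSurjOp_surjective m n ⟨φ, hφ⟩
    induction f using Quotient.ind with
    | _ t =>
      refine ⟨Syn.eval Syn.delta t, ?_⟩
      rw [PROPHom.map_eval, ancestryHom_delta, ← PROPHom.map_eval]
      exact congrArg SurjOp.toFinCorel.map hf

/-- Surjections are the morphisms of `FinCorel°`. -/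
noncomputable def SurjOp.isoCirc : PROPIso SurjOp finCorelCirc.toPROP :=
  PROPIso.ofBijective (SurjOp.toFinCorel.codRestrict finCorelCirc fun f => SurjOp.corel_isCirc f.2)
    (fun _ _ _ _ h => Subtype.ext (SurjOp.corel_injective (congrArg Subtype.val h)))
    (fun _ _ ⟨R, hR⟩ => by
      obtain ⟨φ, hφ, rfl⟩ := SurjOp.exists_corel_eq hR
      exact ⟨⟨φ, hφ⟩, rfl⟩)

/-- Morphisms of `Cocom` as corelations. -/
noncomputable def Cocom.isoCirc : PROPIso Cocom finCorelCirc.toPROP :=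
  PROPIso.ofBijective (SurjOp.isoCirc.hom.comp Cocom.toSurjOp)
    (fun m n _ _ h => Cocom.toSurjOp_injective m n
      (((SurjOp.isoCirc.inv_hom _).symm.trans (congrArg SurjOp.isoCirc.inv.map h)).trans
        (SurjOp.isoCirc.inv_hom _)))
    (fun m n R => by
      obtain ⟨f, hf⟩ := Cocom.toSurjOp_surjective m n (SurjOp.isoCirc.inv.map R)
      exact ⟨f, (congrArg SurjOp.isoCirc.hom.map hf).trans (SurjOp.isoCirc.hom_inv R)⟩)

end AncestryPROP

open AncestryPROP
theorem mainTheorem1 :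
    -- the ancestry assignment is a strict symmetric monoidal functor, identity on objects
    ∃ Pi : PROPHom Syn FinCorel,
      (∀ (m n : ℕ) (f : Syn.Hom m n), Pi.map f = ancestry f) ∧
      -- `FinCorel°` is a sub-PROP, and it is the image of the ancestry functor
      ∃ Circ : SubPROP FinCorel,
        (∀ (m n : ℕ) (R : Corel m n), R ∈ Circ.carrier m n ↔ R.IsCirc) ∧
        (∀ (m n : ℕ) (R : FinCorel.Hom m n),
          (∃ f : Syn.Hom m n, Pi.map f = R) ↔ R ∈ Circ.carrier m n) ∧
        -- the induced functor on the quotient is an isomorphism onto `FinCorel°`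
        (∃ Psi : PROPIso (kerQuot Pi) Circ.toPROP, ∀ (m n : ℕ) (f : Syn.Hom m n),
          (Psi.hom.map ((kerQuot.proj Pi).map f)).1 = Pi.map f) ∧
        -- the quotient is isomorphic to `Cocom`, generator to generator
        (∃ Phi : PROPIso Cocom (kerQuot Pi),
          Phi.hom.map Cocom.delta = (kerQuot.proj Pi).map Syn.delta) ∧
        -- morphisms `m → n` of `Cocom` are the surjections `{1, …, n} → {1, …, m}`
        (∃ Theta : PROPIso Cocom SurjOp, Theta.hom.map Cocom.delta = SurjOp.delta) := by
  have himage : ∀ (m n : ℕ) (R : FinCorel.Hom m n),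
      (∃ f : Syn.Hom m n, ancestryHom.map f = R) ↔ R ∈ finCorelCirc.carrier m n :=
    fun _ _ R => exists_ancestryHom_iff R
  let Psi := kerQuot.isoImage ancestryHom finCorelCirc himage
  refine ⟨ancestryHom, fun _ _ _ => rfl, finCorelCirc, fun _ _ _ => Iff.rfl, himage,
    ⟨Psi, fun _ _ _ => rfl⟩, ⟨Cocom.isoCirc.transSymm Psi, ?_⟩,
    ⟨PROPIso.ofBijective Cocom.toSurjOp Cocom.toSurjOp_injective Cocom.toSurjOp_surjective, rfl⟩⟩
  -- Both isomorphisms onto `FinCorel°` send their generator to the same corelation, so inverting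
  -- `Psi` matches the generators.
  have h : Cocom.isoCirc.hom.map Cocom.delta =
      Psi.hom.map ((kerQuot.proj ancestryHom).map Syn.delta) := Subtype.ext ancestryHom_delta.symm
  exact (congrArg Psi.inv.map h).trans (Psi.inv_hom _)
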